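/- Let $\log^+ r=\max\{1,\log r\}$, let $d\mu(x)=(2\pi)^{-n/2}e^{-|x|^2/2}\,dx$ be the Gaussian measure on $\mathbb R^n$, and for a $C^1$ vector field $f$ on $\mathbb R^n$ put $\mathrm{div}_\mu f(x)=\mathrm{div} f(x)-x\cdot f(x)$. For measurable $g$ let $$\|g\|_{\mathrm{Exp}_\mu(L)}=\inf\Big\{\lambda>0:\int_{\mathbb R^n}\big(e^{|g|/\lambda}-1\big)\,d\mu\le 1\Big\}.$$ **Theorem.** There is a function $C:[1,\infty)\times[0,\infty)\to[0,\infty)$ with the following property. Let $n\ge 0$ be an integer, let $T>0$, and let $b:[0,T]\times\mathbb R^n\to\mathbb R^n$ be Borel with $b(t,\cdot)\in C^2(\mathbb R^n)$ for each $t\in[0,T]$, with $$\int_0^T\sup_{|x|\le R}|D_xb(t,x)|\,dt<\infty\quad\text{for every }R>0,$$ $$\int_0^T\Big\|\frac{b(t,\cdot)}{1+|\cdot|\log^+|\cdot|}\Big\|_{L^\infty}dt<\infty ,\qquad \int_0^T\beta(t)\,dt<\infty,\quad\text{where }\beta(t)=\|\mathrm{div}_\mu b(t,\cdot)\|_{\mathrm{Exp}_\mu(L)}.$$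 Then there is a unique flow $X(s,t,x)$, $0\le s\le t\le T$, $x\in\mathbb R^n$, of $\partial_tX(s,t,x)=b(t,X(s,t,x))$, $X(s,s,x)=x$. That is, there is a Borel map $X$ such that, for every $s\in[0,T]$ and every $x\in\mathbb R^n$, the map $r\mapsto b(r,X(s,r,x))$ is in $L^1(s,T)$ and $$X(s,t,x)=x+\int_s^t b(r,X(s,r,x))\,dr\qquad(s\le t\le T),$$ and $t\mapsto X(s,t,x)$ is the only curve on $[s,T]$ with these two properties. Moreover, for all $0\le s\le t\le T$ the image measure $X(s,t,\cdot)_\#\mu$ is absolutely continuous with respect to $\mu$, and for every $$1\le p<\frac1{1-\exp\left(-4\int_s^t\beta(r)\,dr\right)}$$ (where the right-hand side is $\infty$ if $\int_s^t\beta(r)\,dr=0$) the density $K_{s,t}=\frac{d}{d\mu}\big(X(s,t,\cdot)_\#\mu\big)$ belongs to $L^p(\mu)$ and satisfies $$\int_{\mathbb R^n}K_{s,t}(x)^p\,d\mu(x)\le C\Big(p,\int_s^t\beta(r)\,dr\Big).$$ -/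

import Mathlib

open MeasureTheory Set
open scoped ENNReal NNReal

noncomputable section

/-- The space `ℝⁿ` with its Euclidean norm. -/
abbrev Euc (n : ℕ) : Type := EuclideanSpace ℝ (Fin n)

/-- The convention `log⁺ r = max {1, log r}` (so `log⁺ r = 1` for `0 ≤ r ≤ e`). -/
def logPlus (r : ℝ) : ℝ := max 1 (Real.log r)

/-- The Gaussian measure `dμ = (2π)^(-n/2) exp(-|x|²/2) dx` on `ℝⁿ`. -/
def gaussMeasure (n : ℕ) : Measure (Euc n) :=
  (volume : Measure (Euc n)).withDensity fun x =>
    ENNReal.ofReal ((2 * Real.pi) ^ (-(n : ℝ) / 2) * Real.exp (-‖x‖ ^ 2 / 2))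

/-- The divergence of a differentiable vector field, `∑ i, ∂ᵢ fᵢ`. -/
def divergence {n : ℕ} (f : Euc n → Euc n) (x : Euc n) : ℝ :=
  ∑ i : Fin n, (fderiv ℝ f x (EuclideanSpace.single i (1 : ℝ))) i

/-- The Gaussian divergence `div_μ f (x) = div f (x) - x · f (x)`. -/
def gaussDiv {n : ℕ} (f : Euc n → Euc n) (x : Euc n) : ℝ :=
  divergence f x - inner ℝ x (f x)

/-- The Luxemburg norm of `f` for the Orlicz function `P` and the measure `μ`: the infimum of all
`c > 0` with `∫ P (|f| / c) dμ ≤ 1`. It is `∞` exactly when there is no such `c`. -/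
def luxemburgNorm {α : Type*} [MeasurableSpace α] (P : ℝ → ℝ) (f : α → ℝ) (μ : Measure α) :
    ℝ≥0∞ :=
  ⨅ (c : ℝ≥0) (_ : 0 < c) (_ : ∫⁻ x, ENNReal.ofReal (P (|f x| / (c : ℝ))) ∂μ ≤ 1), (c : ℝ≥0∞)

/-- The norm of the Orlicz space `Exp_μ(L)` over the Gaussian measure, given by the Orlicz function
`r ↦ exp r - 1`. -/
def expNorm {n : ℕ} (f : Euc n → ℝ) : ℝ≥0∞ :=
  luxemburgNorm (fun r => Real.exp r - 1) f (gaussMeasure n)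

/-- `γ` is a trajectory of the field `b` on `[s, T]` that starts from `x` at time `s`: it solves
`γ' = b(·, γ)` in the Carathéodory sense, that is, `b(·, γ) ∈ L¹(s, T)` and
`γ t = x + ∫ₛᵗ b(r, γ r) dr` for every `t ∈ [s, T]`. -/
structure IsTrajectory {n : ℕ} (b : ℝ → Euc n → Euc n) (T s : ℝ) (x : Euc n) (γ : ℝ → Euc n) :
    Prop where
  integrable : IntervalIntegrable (fun r => b r (γ r)) volume s T
  eq_integral : ∀ t ∈ Icc s T, γ t = x + ∫ r in s..t, b r (γ r)

/-- `X` is a (forward) flow of `b` on `[0, T]`: a Borel map for which every `t ↦ X s t x` is a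
trajectory from `x` at time `s`. Only the values `X s t x` with `0 ≤ s ≤ t ≤ T` are relevant. -/
structure IsFlow {n : ℕ} (b : ℝ → Euc n → Euc n) (T : ℝ) (X : ℝ → ℝ → Euc n → Euc n) :
    Prop where
  measurable : Measurable fun q : ℝ × ℝ × Euc n => X q.1 q.2.1 q.2.2
  trajectory : ∀ s ∈ Icc 0 T, ∀ x : Euc n, IsTrajectory b T s x fun t => X s t x

/-- The density `K_{s,t} = d(X(s,t,·)_# μ)/dμ` of the Gaussian measure transported by the map
`Y = X(s,t,·)`. -/
def gaussDensity {n : ℕ} (Y : Euc n → Euc n) : Euc n → ℝ≥0∞ :=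
  ((gaussMeasure n).map Y).rnDeriv (gaussMeasure n)

/-- The number `∫ₛᵗ ‖div_μ b(r,·)‖_{Exp_μ(L)} dr`. -/
def expDivIntegral {n : ℕ} (b : ℝ → Euc n → Euc n) (s t : ℝ) : ℝ :=
  (∫⁻ r in Ioc s t, expNorm (gaussDiv (b r))).toReal

end

open Filter Topology

/-! Growth like `|x| log⁺ |x|` is of Osgood type: the logarithm of a majorant of `|γ|` obeys a
linear Grönwall inequality, so trajectories from a bounded set stay in a fixed ball
(`le_osgoodBound`). There the field is Lipschitz with an integrable constant. Cutoff and Picard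
iteration then give the flow, and Grönwall gives uniqueness.

For the density, let `v(t)` be the Gaussian measure of the image at time `t` of a set `A`. Formally
`v' ≥ -∫ |div_μ b| dμ` over that image. Exponential integrability gives `∫_E |f| dμ ≤ ‖f‖ μ(E) log
(2 / μ(E))` (`setLIntegral_abs_le_luxemburgNorm_mul`), so `L = log (2 / v)` satisfies `L' ≤ β L` and
grows by a factor of at most `exp ∫β`. Applied to compact subsets of the preimage of `D`, this
bounds the transported measure of `D` by `2 (μ(D) / 2) ^ θ` with `θ = exp (-∫β)`
(`IsOsgoodField.measure_preimage_le`). Chebyshev's inequality on `{K > t}` then yields `μ{K > t} ≤ 2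
t ^ (-1 / (1 - θ))` for `t > 1` and `θ < 1`, and the layer-cake formula gives `K ∈ Lᵖ` for `p < 1 /
(1 - θ)`. As `exp (-4 ∫β) ≤ θ`, this covers the stated range, with a constant free of the dimension.

The inequality for `v` is proved with Euler steps `x ↦ x + ∫ b(r, x) dr`, without differentiating
the flow. Space is frozen during a step, so Fubini applies over one fixed set, and the Gaussian
Jacobian of the step is at least `exp (-∫ |div_μ b|)` up to an error small compared with the mass `∫
g` of the step, where `g` is the local Lipschitz constant. These errors add up to a multiple of `η ∫
g`, with `η` arbitrary. Euler's method converges uniformly on a compact set of starting points, and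
closed neighbourhoods of the compact image shrink to it in measure, so the lower bound passes to the
flow. -/

/-! ### Grönwall and Osgood inequalities with integrable coefficients. -/

theorem LipschitzOnWith.comp_absolutelyContinuousOnInterval {F U : ℝ → ℝ} {a b : ℝ} {S : Set ℝ}
    {K : ℝ≥0} (hF : LipschitzOnWith K F S) (hU : AbsolutelyContinuousOnInterval U a b)
    (hS : MapsTo U (uIcc a b) S) : AbsolutelyContinuousOnInterval (fun t => F (U t)) a b := by
  rw [absolutelyContinuousOnInterval_iff] at hU ⊢
  intro ε hε
  obtain ⟨δ, hδ, h⟩ := hU (ε / (K + 1)) (by positivity)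
  refine ⟨δ, hδ, fun E hE hlt => ?_⟩
  have h1 := h E hE hlt
  calc ∑ i ∈ Finset.range E.1, dist (F (U (E.2 i).1)) (F (U (E.2 i).2))
      ≤ ∑ i ∈ Finset.range E.1, (K + 1) * dist (U (E.2 i).1) (U (E.2 i).2) := by
        refine Finset.sum_le_sum fun i hi => ?_
        have hm := hE.1 i (by simpa using hi)
        refine (hF.dist_le_mul _ (hS hm.1) _ (hS hm.2)).trans ?_
        gcongr
        linarith
    _ = (K + 1) * ∑ i ∈ Finset.range E.1, dist (U (E.2 i).1) (U (E.2 i).2) := by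
        rw [Finset.mul_sum]
    _ < (K + 1) * (ε / (K + 1)) := by gcongr
    _ = ε := by field_simp

/-- Chain rule for a `C¹` function of a primitive of an integrable function. -/
theorem intervalIntegral_deriv_comp_primitive {F F' f : ℝ → ℝ} {c a b : ℝ} {S : Set ℝ}
    (hab : a ≤ b) (hf : IntervalIntegrable f volume a b)
    (hF : ∀ y ∈ S, HasDerivAt F (F' y) y) (hF' : ContinuousOn F' S)
    (hU : ∀ t ∈ Icc a b, c + ∫ r in a..t, f r ∈ S) :
    IntervalIntegrable (fun t => F' (c + ∫ r in a..t, f r) * f t) volume a b ∧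
    ∫ t in a..b, F' (c + ∫ r in a..t, f r) * f t = F (c + ∫ r in a..b, f r) - F c := by
  set U : ℝ → ℝ := fun t => c + ∫ r in a..t, f r with hUdef
  have hUac : AbsolutelyContinuousOnInterval U a b := by
    have h1 := hf.absolutelyContinuousOnInterval_intervalIntegral (c := a) left_mem_uIcc
    have h2 : AbsolutelyContinuousOnInterval (fun _ : ℝ => c) a b :=
      (LipschitzOnWith.absolutelyContinuousOnInterval (K := 0)
        ((LipschitzWith.const c).lipschitzOnWith))
    exact h2.add h1
  have hUc : ContinuousOn U (uIcc a b) := hUac.continuousOn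
  rw [uIcc_of_le hab] at hUc
  have himg : U '' Icc a b ⊆ S := by rintro _ ⟨t, ht, rfl⟩; exact hU t ht
  -- `F` need not be Lipschitz on `S`, but it is on the compact interval swept by `U`, which makes
  -- `F ∘ U` absolutely continuous.
  have hcomp : IsCompact (U '' Icc a b) := isCompact_Icc.image_of_continuousOn hUc
  have hconv : Convex ℝ (U '' Icc a b) :=
    ((isPreconnected_Icc.image U hUc).ordConnected).convex
  obtain ⟨K, hK⟩ := hcomp.exists_bound_of_continuousOn (hF'.mono himg)
  have hlip : LipschitzOnWith (Real.toNNReal K) F (U '' Icc a b) := by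
    refine hconv.lipschitzOnWith_of_nnnorm_hasDerivWithin_le (f' := F')
      (fun y hy => (hF y (himg hy)).hasDerivWithinAt) fun y hy => ?_
    rw [← NNReal.coe_le_coe, coe_nnnorm]
    exact (hK y hy).trans (Real.le_coe_toNNReal K)
  have hmaps : MapsTo U (uIcc a b) (U '' Icc a b) := by
    rw [uIcc_of_le hab]; exact mapsTo_image U _
  have hac := hlip.comp_absolutelyContinuousOnInterval hUac hmaps
  have hae : ∀ᵐ t, t ∈ uIoc a b → deriv (fun t => F (U t)) t = F' (U t) * f t := by
    filter_upwards [hf.ae_hasDerivAt_integral] with t ht hmem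
    have htI : t ∈ uIcc a b := uIoc_subset_uIcc hmem
    have h1 : HasDerivAt U (f t) t := (ht htI a left_mem_uIcc).const_add c
    exact ((hF (U t) (hU t (by rwa [uIcc_of_le hab] at htI))).comp t h1).deriv
  constructor
  · refine hac.intervalIntegrable_deriv.congr_ae ?_
    rw [Filter.EventuallyEq, ae_restrict_iff' measurableSet_uIoc]
    exact hae
  · rw [← intervalIntegral.integral_congr_ae hae, hac.integral_deriv_eq_sub]
    simp [U]

/-- Grönwall's inequality with an integrable coefficient. -/
theorem le_mul_exp_of_le_add_integral_mul {u l : ℝ → ℝ} {a b δ : ℝ} (hδ : 0 ≤ δ)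
    (hl : IntervalIntegrable l volume a b) (hl0 : ∀ t, 0 ≤ l t) (hu0 : ∀ t, 0 ≤ u t)
    (hu : ContinuousOn u (Icc a b))
    (h : ∀ t ∈ Icc a b, u t ≤ δ + ∫ r in a..t, l r * u r) :
    ∀ t ∈ Icc a b, u t ≤ δ * Real.exp (∫ r in a..t, l r) := by
  intro t ht
  -- Uniqueness needs `δ = 0`, where the logarithm below is unavailable. The bound is proved for `δ'
  -- > δ` and passed to the limit.
  have key : ∀ δ' > δ, u t ≤ δ' * Real.exp (∫ r in a..t, l r) := by
    intro δ' hδ'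
    have hab : a ≤ t := ht.1
    have hsub : Icc a t ⊆ Icc a b := Icc_subset_Icc_right ht.2
    have hlt : IntervalIntegrable l volume a t :=
      hl.mono_set (by rw [uIcc_of_le hab, uIcc_of_le (ht.1.trans ht.2)]; exact hsub)
    have hlu : IntervalIntegrable (fun r => l r * u r) volume a t :=
      hlt.mul_continuousOn (by rw [uIcc_of_le hab]; exact hu.mono hsub)
    have hpos : ∀ τ ∈ Icc a t, 0 < δ' + ∫ r in a..τ, l r * u r := fun τ hτ => by
      have : 0 ≤ ∫ r in a..τ, l r * u r :=
        intervalIntegral.integral_nonneg hτ.1 fun r _ => mul_nonneg (hl0 r) (hu0 r)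
      linarith
    obtain ⟨h1, h2⟩ := intervalIntegral_deriv_comp_primitive (F := Real.log) (F' := fun y => y⁻¹)
      (S := Ioi 0) (c := δ') hab hlu (fun y hy => Real.hasDerivAt_log (ne_of_gt hy))
      (continuousOn_inv₀.mono fun y hy => ne_of_gt hy) hpos
    have h3 : Real.log (δ' + ∫ r in a..t, l r * u r) - Real.log δ' ≤ ∫ r in a..t, l r := by
      rw [← h2]
      refine intervalIntegral.integral_mono_on hab h1 hlt fun r hr => ?_
      have hp := hpos r hr
      have := h r (hsub hr)
      rw [inv_mul_le_iff₀ hp, mul_comm]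
      exact mul_le_mul_of_nonneg_right (by linarith) (hl0 r)
    have hp := hpos t (right_mem_Icc.2 hab)
    calc u t ≤ δ' + ∫ r in a..t, l r * u r := by linarith [h t ht]
      _ = Real.exp (Real.log (δ' + ∫ r in a..t, l r * u r)) := (Real.exp_log hp).symm
      _ ≤ Real.exp (Real.log δ' + ∫ r in a..t, l r) := Real.exp_le_exp.2 (by linarith)
      _ = δ' * Real.exp (∫ r in a..t, l r) := by rw [Real.exp_add, Real.exp_log (by linarith)]
  have hlim : Tendsto (fun δ' : ℝ => δ' * Real.exp (∫ r in a..t, l r)) (𝓝[>] δ)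
      (𝓝 (δ * Real.exp (∫ r in a..t, l r))) :=
    (continuous_id.mul continuous_const).continuousWithinAt
  exact ge_of_tendsto hlim (eventually_mem_nhdsWithin.mono fun δ' hδ' => key δ' hδ')

theorem logPlus_mono {x y : ℝ} (hx : 0 ≤ x) (hxy : x ≤ y) : logPlus x ≤ logPlus y := by
  unfold logPlus
  rcases hx.eq_or_lt with rfl | hx
  · simp
  · exact max_le_max le_rfl (Real.log_le_log hx hxy)

theorem one_le_logPlus (x : ℝ) : 1 ≤ logPlus x := le_max_left _ _

/-- The discontinuity of `Real.log` at `0` is hidden by the maximum with `1`, as the form `log (max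
e |r|)` shows. -/
theorem continuous_logPlus : Continuous logPlus := by
  have h : logPlus = fun r => Real.log (max (Real.exp 1) |r|) := by
    funext r
    unfold logPlus
    rw [← Real.log_abs r]
    rcases le_total (Real.exp 1) |r| with hr | hr
    · rw [max_eq_right hr, max_eq_right]
      rw [Real.le_log_iff_exp_le ((Real.exp_pos 1).trans_le hr)]
      exact hr
    · rw [max_eq_left hr, Real.log_exp, max_eq_left]
      rcases (abs_nonneg r).eq_or_lt with h0 | h0
      · simp [← h0]
      · rwa [Real.log_le_iff_le_exp h0]
  rw [h]
  refine (continuous_const.max continuous_abs).log fun r => ?_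
  exact ((Real.exp_pos 1).trans_le (le_max_left _ _)).ne'

theorem one_add_mul_logPlus_mono {x y : ℝ} (hx : 0 ≤ x) (hxy : x ≤ y) :
    1 + x * logPlus x ≤ 1 + y * logPlus y := by
  have h1 := logPlus_mono hx hxy
  have h2 := one_le_logPlus x
  have h3 := hx.trans hxy
  gcongr

/-- The a priori bound for integral inequalities `u ≤ c + ∫ A (1 + u log⁺ u)`. -/
noncomputable def osgoodBound (c A : ℝ) : ℝ := Real.exp ((1 + Real.log (1 + c)) * Real.exp (2 * A))

theorem osgoodBound_mono {c c' A A' : ℝ} (hc : 0 ≤ c) (hcc : c ≤ c') (hA : A ≤ A') :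
    osgoodBound c A ≤ osgoodBound c' A' := by
  unfold osgoodBound
  have h1 : 0 ≤ Real.log (1 + c) := Real.log_nonneg (by linarith)
  have h2 : Real.log (1 + c) ≤ Real.log (1 + c') := Real.log_le_log (by linarith) (by linarith)
  have h3 := h1.trans h2
  refine Real.exp_le_exp.2 ?_
  gcongr

/-- Osgood's inequality for the modulus `1 + u log⁺ u`. -/
theorem le_osgoodBound {u A : ℝ → ℝ} {a b c : ℝ} (hc : 0 ≤ c)
    (hA : IntervalIntegrable A volume a b) (hA0 : ∀ t, 0 ≤ A t) (hu0 : ∀ t, 0 ≤ u t)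
    (hu : ContinuousOn u (Icc a b))
    (h : ∀ t ∈ Icc a b, u t ≤ c + ∫ r in a..t, A r * (1 + u r * logPlus (u r))) :
    ∀ t ∈ Icc a b, u t ≤ osgoodBound c (∫ r in a..t, A r) := by
  intro t ht
  have hab : a ≤ b := ht.1.trans ht.2
  set f : ℝ → ℝ := fun r => A r * (1 + u r * logPlus (u r)) with hf
  have hf0 : ∀ r, 0 ≤ f r := fun r =>
    mul_nonneg (hA0 r) (by have := one_le_logPlus (u r); have := hu0 r; positivity)
  have hfi : IntervalIntegrable f volume a b :=
    hA.mul_continuousOn (by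
      rw [uIcc_of_le hab]
      exact continuousOn_const.add (hu.mul (continuous_logPlus.comp_continuousOn hu)))
  -- Starting from `1 + c` keeps `U ≥ 1`, hence `log U ≥ 0` and `1 + U log⁺ U ≤ 2 U (1 + log U)`.
  -- This is the source of the factor `2`: `1 + log U` satisfies a linear inequality with
  -- coefficient `2 A`.
  set U : ℝ → ℝ := fun τ => (1 + c) + ∫ r in a..τ, f r with hU
  have hU1 : ∀ τ ∈ Icc a b, 1 ≤ U τ := fun τ hτ => by
    have : 0 ≤ ∫ r in a..τ, f r := intervalIntegral.integral_nonneg hτ.1 fun r _ => hf0 r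
    simp only [hU]; linarith
  have huU : ∀ τ ∈ Icc a b, u τ ≤ U τ := fun τ hτ => by
    have := h τ hτ; simp only [hU]; linarith
  have hsub : ∀ τ ∈ Icc a b, uIcc a τ ⊆ uIcc a b := fun τ hτ => by
    rw [uIcc_of_le hab, uIcc_of_le hτ.1]; exact Icc_subset_Icc_right hτ.2
  have hUc : ContinuousOn U (Icc a b) := by
    have := intervalIntegral.continuousOn_primitive_interval' hfi left_mem_uIcc
    rw [uIcc_of_le hab] at this
    exact continuousOn_const.add this
  have hlogc : ContinuousOn (fun τ => Real.log (U τ)) (Icc a b) :=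
    hUc.log fun τ hτ => by linarith [hU1 τ hτ]
  -- The maximum only provides nonnegativity outside `[a, b]`, which the Grönwall lemma asks for at
  -- all times.
  let v : ℝ → ℝ := fun τ => max 0 (1 + Real.log (U τ))
  have hv : ∀ τ ∈ Icc a b, v τ = 1 + Real.log (U τ) := fun τ hτ =>
    max_eq_right (by have := Real.log_nonneg (hU1 τ hτ); linarith)
  have hvc : ContinuousOn v (Icc a b) := continuousOn_const.sup (continuousOn_const.add hlogc)
  have h2A : IntervalIntegrable (fun r => 2 * A r) volume a b := hA.const_mul 2
  have hg := le_mul_exp_of_le_add_integral_mul (u := v) (l := fun r => 2 * A r)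
    (δ := 1 + Real.log (1 + c)) (by have := Real.log_nonneg (show 1 ≤ 1 + c by linarith); linarith)
    h2A (fun r => by have := hA0 r; positivity) (fun r => le_max_left _ _) hvc ?_ t ht
  · calc u t ≤ U t := huU t ht
      _ = Real.exp (Real.log (U t)) := (Real.exp_log (by linarith [hU1 t ht])).symm
      _ ≤ osgoodBound c (∫ r in a..t, A r) := by
        refine Real.exp_le_exp.2 ?_
        rw [hv t ht, intervalIntegral.integral_const_mul] at hg
        linarith
  · intro τ hτ
    obtain ⟨h1, h2⟩ := intervalIntegral_deriv_comp_primitive (F := Real.log) (F' := fun y => y⁻¹)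
      (S := Ioi 0) (c := 1 + c) hτ.1 (hfi.mono_set (hsub τ hτ))
      (fun y hy => Real.hasDerivAt_log (ne_of_gt hy))
      (continuousOn_inv₀.mono fun y hy => ne_of_gt hy)
      (fun r hr => by have := hU1 r ⟨hr.1, hr.2.trans hτ.2⟩; simp only [hU] at this; simp; linarith)
    have h3 : Real.log (U τ) - Real.log (1 + c) ≤ ∫ r in a..τ, 2 * A r * v r := by
      rw [← h2]
      refine intervalIntegral.integral_mono_on hτ.1 h1 ?_ fun r hr => ?_
      · refine (h2A.mono_set (hsub τ hτ)).mul_continuousOn (hvc.mono ?_)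
        rw [uIcc_of_le hτ.1]; exact Icc_subset_Icc_right hτ.2
      · have hr' : r ∈ Icc a b := ⟨hr.1, hr.2.trans hτ.2⟩
        have hU1r := hU1 r hr'
        change (U r)⁻¹ * f r ≤ _
        rw [inv_mul_le_iff₀ (by linarith), hv r hr', hf]
        have hlog : 0 ≤ Real.log (U r) := Real.log_nonneg hU1r
        have hlp : logPlus (U r) ≤ 1 + Real.log (U r) := max_le (by linarith) (by linarith)
        have h4 := one_add_mul_logPlus_mono (hu0 r) (huU r hr')
        have h5 : 1 + U r * logPlus (U r) ≤ U r * (2 * (1 + Real.log (U r))) := by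
          nlinarith
        calc A r * (1 + u r * logPlus (u r)) ≤ A r * (U r * (2 * (1 + Real.log (U r)))) :=
              mul_le_mul_of_nonneg_left (h4.trans h5) (hA0 r)
          _ = _ := by ring
    rw [hv τ hτ]
    linarith

/-! ### Carathéodory flows of globally Lipschitz fields. -/

section CaratheodoryODE

variable {E : Type*} [NormedAddCommGroup E] [NormedSpace ℝ E] [MeasurableSpace E] [BorelSpace E]
  [SecondCountableTopology E]

theorem measurable_setIntegral_Ioc {Q : Type*} [MeasurableSpace Q] {f : Q → ℝ → E}
    (hf : Measurable (Function.uncurry f)) {s t : Q → ℝ} (hs : Measurable s) (ht : Measurable t) :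
    Measurable fun q => ∫ r in Ioc (s q) (t q), f q r := by
  have hset : MeasurableSet {p : Q × ℝ | s p.1 < p.2 ∧ p.2 ≤ t p.1} :=
    (measurableSet_lt (hs.comp measurable_fst) measurable_snd).inter
      (measurableSet_le measurable_snd (ht.comp measurable_fst))
  have h := ((hf.indicator hset).stronglyMeasurable.integral_prod_right'
    (ν := (volume : Measure ℝ))).measurable
  convert! h using 2 with q
  rw [← integral_indicator measurableSet_Ioc]
  rfl

/-- A time-dependent field that is bounded and Lipschitz in space, with integrable bounds. -/
structure IsLipschitzField (c : ℝ → E → E) (l m : ℝ → ℝ) : Prop where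
  measurable : Measurable (Function.uncurry c)
  integrable_lip : Integrable l
  integrable_bound : Integrable m
  lip_nonneg : ∀ t, 0 ≤ l t
  lip : ∀ t x y, ‖c t x - c t y‖ ≤ l t * ‖x - y‖
  bound : ∀ t x, ‖c t x‖ ≤ m t

/-- Picard iterates for `∂ₜ X(s,t,x) = c(t, X(s,t,x))`, `X(s,s,x) = x`. -/
noncomputable def picardIterate (c : ℝ → E → E) : ℕ → ℝ → ℝ → E → E
  | 0, _, _, x => x
  | k + 1, s, t, x => x + ∫ r in Ioc s t, c r (picardIterate c k s r x)

namespace IsLipschitzField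

variable {c : ℝ → E → E} {l m : ℝ → ℝ}

theorem measurable_picardIterate (hc : IsLipschitzField c l m) (k : ℕ) :
    Measurable fun q : ℝ × ℝ × E => picardIterate c k q.1 q.2.1 q.2.2 := by
  induction k with
  | zero => exact measurable_snd.snd
  | succ k ih =>
    refine measurable_snd.snd.add ?_
    refine measurable_setIntegral_Ioc (Q := ℝ × ℝ × E)
      (f := fun q r => c r (picardIterate c k q.1 r q.2.2)) ?_ measurable_fst measurable_snd.fst
    refine hc.measurable.comp (measurable_snd.prodMk ?_)
    exact ih.comp (measurable_fst.fst.prodMk (measurable_snd.prodMk measurable_fst.snd.snd))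

theorem integrable_comp (hc : IsLipschitzField c l m) {γ : ℝ → E} (hγ : Measurable γ) :
    Integrable fun r => c r (γ r) :=
  hc.integrable_bound.mono' (hc.measurable.comp (measurable_id.prodMk hγ)).aestronglyMeasurable
    (Eventually.of_forall fun r => hc.bound r _)

theorem measurable_picardIterate_time (hc : IsLipschitzField c l m) (k : ℕ) (s : ℝ) (x : E) :
    Measurable fun r => picardIterate c k s r x :=
  (hc.measurable_picardIterate k).comp
    (measurable_const.prodMk (measurable_id.prodMk measurable_const))

/-- Bielecki's weight: integrating `l` against `exp (2 ∫ l)` gains a factor `1 / 2`, so the Picard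
map contracts over any length of time. -/
theorem integral_lip_mul_exp_le (hc : IsLipschitzField c l m) {s t : ℝ} (hst : s ≤ t) :
    IntervalIntegrable (fun r => l r * Real.exp (2 * ∫ τ in s..r, l τ)) volume s t ∧
    ∫ r in s..t, l r * Real.exp (2 * ∫ τ in s..r, l τ) ≤ Real.exp (2 * ∫ τ in s..t, l τ) / 2 := by
  obtain ⟨h1, h2⟩ := intervalIntegral_deriv_comp_primitive (F := fun y => Real.exp (2 * y) / 2)
    (F' := fun y => Real.exp (2 * y)) (S := univ) (c := 0) hst
    (hc.integrable_lip.intervalIntegrable (a := s) (b := t)) (fun y _ => by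
      have := (((hasDerivAt_id y).const_mul 2).exp).div_const 2
      simpa using this) (by fun_prop) (fun _ _ => mem_univ _)
  simp only [zero_add] at h1 h2
  refine ⟨by simpa only [mul_comm] using h1, ?_⟩
  simp only [mul_comm (l _)]
  rw [h2]
  simp

/-- Each iteration gains the factor `1 / 2` of the weighted estimate. The `max s t` covers `t < s`,
where `Ioc s t` is empty and all iterates equal `x`. -/
theorem norm_picardIterate_succ_sub_le (hc : IsLipschitzField c l m) (k : ℕ) (s t : ℝ) (x : E) :
    ‖picardIterate c (k + 1) s t x - picardIterate c k s t x‖ ≤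
      (∫ r, m r) * (1 / 2) ^ k * Real.exp (2 * ∫ r in s..(max s t), l r) := by
  have hm0 : ∀ r, 0 ≤ m r := fun r => (norm_nonneg _).trans (hc.bound r 0)
  have hM0 : 0 ≤ ∫ r, m r := integral_nonneg hm0
  induction k generalizing t with
  | zero =>
    have h1 : ‖∫ r in Ioc s t, c r x‖ ≤ ∫ r, m r :=
      (norm_integral_le_of_norm_le hc.integrable_bound.integrableOn
        (Eventually.of_forall fun r => hc.bound r x)).trans
        (setIntegral_le_integral hc.integrable_bound (Eventually.of_forall hm0))
    have h2 : 1 ≤ Real.exp (2 * ∫ r in s..(max s t), l r) := by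
      refine Real.one_le_exp (mul_nonneg zero_le_two ?_)
      exact intervalIntegral.integral_nonneg (le_max_left _ _) fun r _ => hc.lip_nonneg r
    simp only [picardIterate, add_sub_cancel_left, pow_zero, mul_one]
    nlinarith
  | succ k ih =>
    rcases lt_or_ge t s with hts | hst
    · have : ∀ k, picardIterate c (k + 1) s t x = x := fun k => by
        simp [picardIterate, Ioc_eq_empty hts.not_gt]
      rw [this, this, sub_self, norm_zero]
      positivity
    · rw [max_eq_right hst]
      have e : picardIterate c (k + 1 + 1) s t x - picardIterate c (k + 1) s t x =
          ∫ r in Ioc s t, (c r (picardIterate c (k + 1) s r x) - c r (picardIterate c k s r x)) := by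
        rw [integral_sub (hc.integrable_comp (hc.measurable_picardIterate_time _ s x)).integrableOn
          (hc.integrable_comp (hc.measurable_picardIterate_time _ s x)).integrableOn]
        simp only [picardIterate, add_sub_add_left_eq_sub]
      obtain ⟨h1, h2⟩ := hc.integral_lip_mul_exp_le hst
      rw [e]
      calc ‖∫ r in Ioc s t, (c r (picardIterate c (k + 1) s r x) - c r (picardIterate c k s r x))‖
          ≤ ∫ r in Ioc s t, ((∫ r, m r) * (1 / 2) ^ k) *
              (l r * Real.exp (2 * ∫ τ in s..r, l τ)) := by
            refine norm_integral_le_of_norm_le (h1.1.const_mul _) ?_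
            rw [ae_restrict_iff' measurableSet_Ioc]
            refine Eventually.of_forall fun r hr => (hc.lip r _ _).trans ?_
            have h3 := ih r
            rw [max_eq_right hr.1.le] at h3
            calc _ ≤ l r * _ := mul_le_mul_of_nonneg_left h3 (hc.lip_nonneg r)
              _ = _ := by ring
        _ = ((∫ r, m r) * (1 / 2) ^ k) * ∫ r in s..t, l r * Real.exp (2 * ∫ τ in s..r, l τ) := by
            rw [integral_const_mul, intervalIntegral.integral_of_le hst]
        _ ≤ ((∫ r, m r) * (1 / 2) ^ k) * (Real.exp (2 * ∫ τ in s..t, l τ) / 2) := by gcongr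
        _ = _ := by ring

/-- Carathéodory's existence theorem for Lipschitz fields, with Borel dependence on all
variables. -/
theorem exists_flow [CompleteSpace E] (hc : IsLipschitzField c l m) :
    ∃ X : ℝ → ℝ → E → E, Measurable (fun q : ℝ × ℝ × E => X q.1 q.2.1 q.2.2) ∧
      ∀ s t x, X s t x = x + ∫ r in Ioc s t, c r (X s r x) := by
  have hlim : ∀ s t x, ∃ y, Tendsto (fun k => picardIterate c k s t x) atTop (𝓝 y) := by
    intro s t x
    refine cauchySeq_tendsto_of_complete (cauchySeq_of_le_geometric (1 / 2)
      ((∫ r, m r) * Real.exp (2 * ∫ r in s..(max s t), l r)) (by norm_num) fun k => ?_)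
    rw [dist_comm, dist_eq_norm]
    exact (hc.norm_picardIterate_succ_sub_le k s t x).trans_eq (by ring)
  choose X hX using hlim
  have hXm : Measurable (fun q : ℝ × ℝ × E => X q.1 q.2.1 q.2.2) :=
    measurable_of_tendsto_metrizable hc.measurable_picardIterate
      (tendsto_pi_nhds.2 fun q => hX q.1 q.2.1 q.2.2)
  refine ⟨X, hXm, fun s t x => tendsto_nhds_unique ((hX s t x).comp (tendsto_add_atTop_nat 1)) ?_⟩
  refine tendsto_const_nhds.add (tendsto_integral_of_dominated_convergence m (fun k => ?_)
    hc.integrable_bound.integrableOn (fun k => Eventually.of_forall fun r => hc.bound r _)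
    (Eventually.of_forall fun r => ?_))
  · exact (hc.integrable_comp (hc.measurable_picardIterate_time k s x)).aestronglyMeasurable.restrict
  · have hcont : Continuous (c r) :=
      (LipschitzWith.of_dist_le_mul (K := ⟨l r, hc.lip_nonneg r⟩) fun x y => by
        rw [dist_eq_norm, dist_eq_norm]; exact hc.lip r x y).continuous
    exact (hcont.tendsto _).comp (hX s r x)

end IsLipschitzField

end CaratheodoryODE

/-! ### Flows of locally Lipschitz fields of Osgood growth. -/

/-- A time-dependent field of growth `|x| log⁺ |x|` that is locally Lipschitz in space, with
integrable constants. -/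
structure IsOsgoodField {n : ℕ} (b : ℝ → Euc n → Euc n) (a : ℝ → ℝ) : Prop where
  measurable : Measurable (Function.uncurry b)
  integrable_growth : Integrable a
  growth_nonneg : ∀ t, 0 ≤ a t
  growth : ∀ t x, ‖b t x‖ ≤ a t * (1 + ‖x‖ * logPlus ‖x‖)
  locallyLipschitz : ∀ R : ℝ, ∃ l : ℝ → ℝ, Integrable l ∧ (∀ t, 0 ≤ l t) ∧
    ∀ t x y, ‖x‖ ≤ R → ‖y‖ ≤ R → ‖b t x - b t y‖ ≤ l t * ‖x - y‖

theorem IsTrajectory.continuousOn {n : ℕ} {b : ℝ → Euc n → Euc n} {T s : ℝ} {x : Euc n}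
    {γ : ℝ → Euc n} (h : IsTrajectory b T s x γ) (hsT : s ≤ T) : ContinuousOn γ (Icc s T) := by
  have h1 := intervalIntegral.continuousOn_primitive_interval' h.integrable left_mem_uIcc
  rw [uIcc_of_le hsT] at h1
  exact (continuousOn_const.add h1).congr h.eq_integral

theorem IsTrajectory.mono {n : ℕ} {b : ℝ → Euc n → Euc n} {T T' s : ℝ} {x : Euc n}
    {γ : ℝ → Euc n} (h : IsTrajectory b T s x γ) (hsT : s ≤ T') (hT : T' ≤ T) :
    IsTrajectory b T' s x γ where
  integrable := h.integrable.mono_set (by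
    rw [uIcc_of_le hsT, uIcc_of_le (hsT.trans hT)]; exact Icc_subset_Icc_right hT)
  eq_integral t ht := h.eq_integral t ⟨ht.1, ht.2.trans hT⟩

/-- A priori bound for trajectories of fields of growth `|x| log⁺ |x|`. -/
theorem IsTrajectory.norm_le_osgoodBound {n : ℕ} {b : ℝ → Euc n → Euc n} {a : ℝ → ℝ} {T s : ℝ}
    {x : Euc n} {γ : ℝ → Euc n} (h : IsTrajectory b T s x γ) (ha : Integrable a)
    (ha0 : ∀ t, 0 ≤ a t) (hb : ∀ t x, ‖b t x‖ ≤ a t * (1 + ‖x‖ * logPlus ‖x‖)) :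
    ∀ t ∈ Icc s T, ‖γ t‖ ≤ osgoodBound ‖x‖ (∫ r, a r) := by
  intro t ht
  have hsT : s ≤ T := ht.1.trans ht.2
  have hγ := (h.continuousOn hsT).norm
  refine (le_osgoodBound (norm_nonneg x) ha.intervalIntegrable ha0 (fun r => norm_nonneg (γ r)) hγ
    (fun τ hτ => ?_) t ht).trans (osgoodBound_mono (norm_nonneg x) le_rfl ?_)
  · rw [h.eq_integral τ hτ]
    refine (norm_add_le _ _).trans (add_le_add_right ?_ _)
    refine intervalIntegral.norm_integral_le_of_norm_le hτ.1
      (Eventually.of_forall fun r _ => hb r (γ r)) ?_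
    refine (ha.intervalIntegrable (a := s) (b := τ)).mul_continuousOn ?_
    rw [uIcc_of_le hτ.1]
    have hγ' := hγ.mono (Icc_subset_Icc_right hτ.2)
    exact continuousOn_const.add (hγ'.mul (continuous_logPlus.comp_continuousOn hγ'))
  · rw [intervalIntegral.integral_of_le ht.1]
    exact setIntegral_le_integral ha (Eventually.of_forall ha0)

/-- Stability of trajectories that stay in a ball. -/
theorem IsTrajectory.norm_sub_le {n : ℕ} {b : ℝ → Euc n → Euc n} {T s R : ℝ}
    {x y : Euc n} {γ γ' : ℝ → Euc n} (h : IsTrajectory b T s x γ) (h' : IsTrajectory b T s y γ')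
    (hγ : ∀ t ∈ Icc s T, ‖γ t‖ ≤ R) (hγ' : ∀ t ∈ Icc s T, ‖γ' t‖ ≤ R) {l : ℝ → ℝ}
    (hl : Integrable l) (hl0 : ∀ t, 0 ≤ l t)
    (hlip : ∀ t x y, ‖x‖ ≤ R → ‖y‖ ≤ R → ‖b t x - b t y‖ ≤ l t * ‖x - y‖) :
    ∀ t ∈ Icc s T, ‖γ t - γ' t‖ ≤ ‖x - y‖ * Real.exp (∫ r in s..t, l r) := by
  intro t ht
  have hsT : s ≤ T := ht.1.trans ht.2
  have hcont := ((h.continuousOn hsT).sub (h'.continuousOn hsT)).norm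
  refine le_mul_exp_of_le_add_integral_mul (norm_nonneg _) hl.intervalIntegrable hl0
    (fun r => norm_nonneg (γ r - γ' r)) hcont (fun τ hτ => ?_) t ht
  have e : γ τ - γ' τ = (x - y) + ∫ r in s..τ, (b r (γ r) - b r (γ' r)) := by
    rw [intervalIntegral.integral_sub (h.mono hτ.1 hτ.2).integrable (h'.mono hτ.1 hτ.2).integrable,
      h.eq_integral τ hτ, h'.eq_integral τ hτ]
    abel
  rw [e]
  refine (norm_add_le _ _).trans (add_le_add_right ?_ _)
  refine intervalIntegral.norm_integral_le_of_norm_le hτ.1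
    (Eventually.of_forall fun r hr => ?_) ?_
  · have hr' : r ∈ Icc s T := ⟨hr.1.le, hr.2.trans hτ.2⟩
    exact hlip r _ _ (hγ r hr') (hγ' r hr')
  · refine (hl.intervalIntegrable (a := s) (b := τ)).mul_continuousOn ?_
    rw [uIcc_of_le hτ.1]
    exact hcont.mono (Icc_subset_Icc_right hτ.2)

/-- A cutoff function: `1` on the ball of radius `R`, `0` off the ball of radius `R + 1`. -/
noncomputable def radialCutoff {n : ℕ} (R : ℝ) (x : Euc n) : ℝ := max 0 (min 1 (R + 1 - ‖x‖))

section radialCutoff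

variable {n : ℕ} (R : ℝ)

theorem radialCutoff_nonneg (x : Euc n) : 0 ≤ radialCutoff R x := le_max_left _ _

theorem radialCutoff_le_one (x : Euc n) : radialCutoff R x ≤ 1 :=
  max_le zero_le_one (min_le_left _ _)

theorem radialCutoff_eq_one {x : Euc n} (hx : ‖x‖ ≤ R) : radialCutoff R x = 1 := by
  unfold radialCutoff
  rw [min_eq_left (by linarith), max_eq_right zero_le_one]

theorem radialCutoff_eq_zero {x : Euc n} (hx : R + 1 ≤ ‖x‖) : radialCutoff R x = 0 := by
  unfold radialCutoff
  rw [max_eq_left]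
  exact (min_le_right _ _).trans (by linarith)

theorem abs_radialCutoff_sub_le (x y : Euc n) :
    |radialCutoff R x - radialCutoff R y| ≤ ‖x - y‖ := by
  unfold radialCutoff
  rw [max_comm 0, max_comm 0]
  refine (abs_max_sub_max_le_abs _ _ _).trans ?_
  have h1 : |min 1 (R + 1 - ‖x‖) - min 1 (R + 1 - ‖y‖)| ≤ |(R + 1 - ‖x‖) - (R + 1 - ‖y‖)| := by
    simpa using abs_min_sub_min_le_max 1 (R + 1 - ‖x‖) 1 (R + 1 - ‖y‖)
  refine h1.trans ?_
  rw [sub_sub_sub_cancel_left, norm_sub_rev]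
  exact abs_norm_sub_norm_le y x

theorem measurable_radialCutoff : Measurable (radialCutoff R : Euc n → ℝ) :=
  measurable_const.max (measurable_const.min (measurable_const.sub measurable_norm))

end radialCutoff

namespace IsOsgoodField

variable {n : ℕ} {b : ℝ → Euc n → Euc n} {a : ℝ → ℝ}

theorem norm_le_of_norm_le (hb : IsOsgoodField b a) {R : ℝ} (t : ℝ) {x : Euc n} (hx : ‖x‖ ≤ R) :
    ‖b t x‖ ≤ a t * (1 + R * logPlus R) :=
  (hb.growth t x).trans (mul_le_mul_of_nonneg_left
    (one_add_mul_logPlus_mono (norm_nonneg x) hx) (hb.growth_nonneg t))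

/-- A product rule: the Lipschitz constant is that of `b` on the larger ball plus its bound there.
If one point lies outside that ball, the cutoff at the other is at most their distance. -/
theorem isLipschitzField_cutoff (hb : IsOsgoodField b a) {R : ℝ} (hR : 0 ≤ R) :
    ∃ l m, IsLipschitzField (fun t x => radialCutoff R x • b t x) l m := by
  obtain ⟨l, hl, hl0, hlip⟩ := hb.locallyLipschitz (R + 1)
  set m : ℝ → ℝ := fun t => a t * (1 + (R + 1) * logPlus (R + 1)) with hm
  have hlp := one_le_logPlus (R + 1)
  have hmi : Integrable m := hb.integrable_growth.mul_const _
  have hm0 : ∀ t, 0 ≤ m t := fun t => mul_nonneg (hb.growth_nonneg t) (by positivity)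
  have hmb : ∀ t x, ‖x‖ ≤ R + 1 → ‖b t x‖ ≤ m t := fun t x hx => hb.norm_le_of_norm_le t hx
  have hmain : ∀ t (x y : Euc n), ‖x‖ ≤ R + 1 →
      ‖radialCutoff R x • b t x - radialCutoff R y • b t y‖ ≤ (l t + m t) * ‖x - y‖ := by
    intro t x y hx
    rcases le_total (R + 1) ‖y‖ with hy | hy
    · have h1 : radialCutoff R x ≤ ‖x - y‖ := by
        have := abs_radialCutoff_sub_le R x y
        rw [radialCutoff_eq_zero R hy, sub_zero] at this
        exact (le_abs_self _).trans this
      rw [radialCutoff_eq_zero R hy, zero_smul, sub_zero, norm_smul,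
        Real.norm_of_nonneg (radialCutoff_nonneg R x)]
      have h2 := hmb t x hx
      have h3 := hl0 t
      have h4 := radialCutoff_nonneg R x
      calc _ ≤ ‖x - y‖ * m t := by gcongr
        _ ≤ _ := by nlinarith [norm_nonneg (x - y)]
    · have e : radialCutoff R x • b t x - radialCutoff R y • b t y =
          radialCutoff R x • (b t x - b t y) + (radialCutoff R x - radialCutoff R y) • b t y := by
        module
      rw [e]
      refine (norm_add_le _ _).trans ?_
      rw [norm_smul, norm_smul, Real.norm_of_nonneg (radialCutoff_nonneg R x), Real.norm_eq_abs]
      have h1 := hlip t x y hx hy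
      have h2 := radialCutoff_le_one R x
      have h3 := abs_radialCutoff_sub_le R x y
      have h4 := hmb t y hy
      calc _ ≤ 1 * (l t * ‖x - y‖) + ‖x - y‖ * m t := by gcongr
        _ = _ := by ring
  refine ⟨fun t => l t + m t, m, ⟨?_, hl.add hmi, hmi, fun t => add_nonneg (hl0 t) (hm0 t), ?_, ?_⟩⟩
  · exact ((measurable_radialCutoff R).comp measurable_snd).smul hb.measurable
  · intro t x y
    rcases le_total ‖x‖ (R + 1) with hx | hx
    · exact hmain t x y hx
    · rcases le_total ‖y‖ (R + 1) with hy | hy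
      · rw [norm_sub_rev, norm_sub_rev x y]
        exact hmain t y x hy
      · rw [radialCutoff_eq_zero R hx, radialCutoff_eq_zero R hy]
        simp only [zero_smul, sub_zero, norm_zero]
        exact mul_nonneg (add_nonneg (hl0 t) (hm0 t)) (norm_nonneg _)
  · intro t x
    rcases le_total ‖x‖ (R + 1) with hx | hx
    · rw [norm_smul, Real.norm_of_nonneg (radialCutoff_nonneg R x)]
      exact (mul_le_of_le_one_left (norm_nonneg _) (radialCutoff_le_one R x)).trans (hmb t x hx)
    · rw [radialCutoff_eq_zero R hx, zero_smul, norm_zero]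
      exact hm0 t

theorem exists_flow (hb : IsOsgoodField b a) :
    ∃ X : ℝ → ℝ → Euc n → Euc n, Measurable (fun q : ℝ × ℝ × Euc n => X q.1 q.2.1 q.2.2) ∧
      ∀ s T x, s ≤ T → IsTrajectory b T s x fun t => X s t x := by
  have hc : ∀ N : ℕ, ∃ X : ℝ → ℝ → Euc n → Euc n,
      Measurable (fun q : ℝ × ℝ × Euc n => X q.1 q.2.1 q.2.2) ∧
      ∀ s T x, s ≤ T → IsTrajectory (fun t x => radialCutoff N x • b t x) T s x
        fun t => X s t x := by
    intro N
    obtain ⟨l, m, h⟩ := hb.isLipschitzField_cutoff (Nat.cast_nonneg N)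
    obtain ⟨X, hX, hXe⟩ := h.exists_flow
    refine ⟨X, hX, fun s T x hsT => ⟨?_, fun t ht => ?_⟩⟩
    · exact (h.integrable_comp (hX.comp
        (measurable_const.prodMk (measurable_id.prodMk measurable_const)))).intervalIntegrable
    · rw [intervalIntegral.integral_of_le ht.1]
      exact hXe s t x
  choose X hX hXt using hc
  -- The cutoff preserves the growth bound, so the a priori estimate does not depend on the cutoff
  -- level. At level `N x` the cutoff equals `1` along the whole trajectory from `x`. An integer
  -- level keeps the glued flow Borel.
  let N : Euc n → ℕ := fun x => ⌈osgoodBound ‖x‖ (∫ r, a r)⌉₊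
  have hN : Measurable N := by
    refine Nat.measurable_ceil.comp ?_
    unfold osgoodBound
    fun_prop
  refine ⟨fun s t x => X (N x) s t x, ?_, fun s T x hsT => ?_⟩
  · have h1 : Measurable fun p : ℕ × ℝ × ℝ × Euc n => X p.1 p.2.1 p.2.2.1 p.2.2.2 :=
      measurable_from_prod_countable_right hX
    exact h1.comp ((hN.comp measurable_snd.snd).prodMk measurable_id)
  · have h1 := hXt (N x) s T x hsT
    have h2 := h1.norm_le_osgoodBound hb.integrable_growth hb.growth_nonneg fun t y => by
      rw [norm_smul, Real.norm_of_nonneg (radialCutoff_nonneg _ y)]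
      exact (mul_le_of_le_one_left (norm_nonneg _) (radialCutoff_le_one _ y)).trans (hb.growth t y)
    have h3 : ∀ t ∈ Icc s T, radialCutoff (N x) (X (N x) s t x) • b t (X (N x) s t x) =
        b t (X (N x) s t x) := fun t ht => by
      rw [radialCutoff_eq_one _ ((h2 t ht).trans (Nat.le_ceil _)), one_smul]
    refine ⟨h1.integrable.congr fun t ht => ?_, fun t ht => ?_⟩
    · rw [uIoc_of_le hsT] at ht
      exact h3 t (Ioc_subset_Icc_self ht)
    · refine (h1.eq_integral t ht).trans ?_
      congr 1
      refine intervalIntegral.integral_congr fun r hr => ?_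
      rw [uIcc_of_le ht.1] at hr
      exact h3 r ⟨hr.1, hr.2.trans ht.2⟩

theorem trajectory_unique (hb : IsOsgoodField b a) {T s : ℝ} {x : Euc n} {γ γ' : ℝ → Euc n}
    (h : IsTrajectory b T s x γ) (h' : IsTrajectory b T s x γ') :
    ∀ t ∈ Icc s T, γ t = γ' t := by
  intro t ht
  obtain ⟨l, hl, hl0, hlip⟩ := hb.locallyLipschitz (osgoodBound ‖x‖ (∫ r, a r))
  have h1 := h.norm_sub_le h'
    (h.norm_le_osgoodBound hb.integrable_growth hb.growth_nonneg hb.growth)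
    (h'.norm_le_osgoodBound hb.integrable_growth hb.growth_nonneg hb.growth) hl hl0 hlip t ht
  rw [sub_self, norm_zero, zero_mul] at h1
  exact sub_eq_zero.1 (norm_le_zero_iff.1 h1)

end IsOsgoodField

/-! ### The Gaussian measure and exponential integrability. -/

/-- The density of the Gaussian measure. -/
noncomputable def gaussPDF (n : ℕ) (x : Euc n) : ℝ :=
  (2 * Real.pi) ^ (-(n : ℝ) / 2) * Real.exp (-‖x‖ ^ 2 / 2)

theorem gaussMeasure_eq (n : ℕ) : gaussMeasure n =
    (volume : Measure (Euc n)).withDensity fun x => ENNReal.ofReal (gaussPDF n x) := rfl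

theorem gaussPDF_pos (n : ℕ) (x : Euc n) : 0 < gaussPDF n x := by
  unfold gaussPDF
  positivity

theorem measurable_gaussPDF (n : ℕ) : Measurable fun x => ENNReal.ofReal (gaussPDF n x) := by
  unfold gaussPDF
  fun_prop

instance isProbabilityMeasure_gaussMeasure (n : ℕ) : IsProbabilityMeasure (gaussMeasure n) := by
  have h : ∫ x : Euc n, gaussPDF n x = 1 := by
    have h1 := GaussianFourier.integral_rexp_neg_mul_sq_norm (V := Euc n)
      (b := 1 / 2) (by norm_num)
    have h2 : ∀ x : Euc n, gaussPDF n x =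
        (2 * Real.pi) ^ (-(n : ℝ) / 2) * Real.exp (-(1 / 2) * ‖x‖ ^ 2) := fun x => by
      unfold gaussPDF
      congr 2
      ring
    simp_rw [h2]
    rw [integral_const_mul, h1, finrank_euclideanSpace, Fintype.card_fin,
      show Real.pi / (1 / 2) = 2 * Real.pi by ring, ← Real.rpow_add (by positivity)]
    rw [show -(n : ℝ) / 2 + (n : ℝ) / 2 = 0 by ring, Real.rpow_zero]
  constructor
  rw [gaussMeasure_eq, withDensity_apply _ MeasurableSet.univ, setLIntegral_univ,
    ← ofReal_integral_eq_lintegral_ofReal (integrable_of_integral_eq_one h)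
      (Eventually.of_forall fun x => (gaussPDF_pos n x).le), h, ENNReal.ofReal_one]

/-- Integrals of an `Exp(L)` function over a set, from its Luxemburg norm. -/
theorem setLIntegral_abs_le_luxemburgNorm_mul {α : Type*} [MeasurableSpace α] {μ : Measure α}
    [IsProbabilityMeasure μ] (f : α → ℝ) {A : Set α}
    (hv : 0 < μ.real A) :
    ∫⁻ x in A, ENNReal.ofReal |f x| ∂μ ≤
      luxemburgNorm (fun r => Real.exp r - 1) f μ *
        ENNReal.ofReal (μ.real A * Real.log (2 / μ.real A)) := by
  set v := μ.real A with hvdef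
  have hv1 : v ≤ 1 := measureReal_le_one
  set m := Real.log (2 / v) with hm
  have hm0 : 0 < m := Real.log_pos (by rw [lt_div_iff₀ hv]; linarith)
  have hK : 0 < v * m := by positivity
  have hμA : μ A = ENNReal.ofReal v := (ofReal_measureReal (measure_ne_top μ A)).symm
  have key : ∀ c : ℝ≥0, 0 < c →
      ∫⁻ x, ENNReal.ofReal ((fun r => Real.exp r - 1) (|f x| / (c : ℝ))) ∂μ ≤ 1 →
      ∫⁻ x in A, ENNReal.ofReal |f x| ∂μ ≤ c * ENNReal.ofReal (v * m) := by
    intro c hc h1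
    have hy : ∫⁻ x in A, ENNReal.ofReal (|f x| / c) ∂μ ≤ ENNReal.ofReal (v * m) := by
      -- Young's inequality at `m = log (2 / v)`: `y + 1 ≤ m + exp (y - m) = m + (v / 2) exp y`.
      -- After integration the excess is `v / 2 + v² / 2 ≤ v`, which cancels the `1` added on the
      -- left; this is why the logarithm contains a `2`.
      have h2 : ∫⁻ x in A, (ENNReal.ofReal (|f x| / c) + 1) ∂μ ≤
          ∫⁻ x in A, (ENNReal.ofReal (v / 2) * ENNReal.ofReal (Real.exp (|f x| / c) - 1) +
            ENNReal.ofReal (m + v / 2)) ∂μ := by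
        refine lintegral_mono fun x => ?_
        have hy0 : 0 ≤ |f x| / (c : ℝ) := by positivity
        have he : 0 ≤ Real.exp (|f x| / c) - 1 := by
          have := Real.one_le_exp hy0; linarith
        rw [← ENNReal.ofReal_one, ← ENNReal.ofReal_add hy0 zero_le_one,
          ← ENNReal.ofReal_mul (by positivity), ← ENNReal.ofReal_add (by positivity)
          (by positivity)]
        refine ENNReal.ofReal_le_ofReal ?_
        have h3 := Real.add_one_le_exp (|f x| / c - m)
        rw [Real.exp_sub, hm, Real.exp_log (by positivity)] at h3
        rw [← hm] at h3
        have h4 : Real.exp (|f x| / c) / (2 / v) = v / 2 * Real.exp (|f x| / c) := by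
          field_simp
        linarith
      rw [lintegral_add_right _ measurable_const, lintegral_add_right _ measurable_const,
        lintegral_const_mul' _ _ ENNReal.ofReal_ne_top, setLIntegral_const, setLIntegral_const,
        one_mul, hμA] at h2
      have h5 : ∫⁻ x in A, ENNReal.ofReal (Real.exp (|f x| / c) - 1) ∂μ ≤ 1 :=
        (setLIntegral_le_lintegral _ _).trans h1
      have h6 : ∫⁻ x in A, ENNReal.ofReal (|f x| / c) ∂μ + ENNReal.ofReal v ≤
          ENNReal.ofReal (v * m) + ENNReal.ofReal v := by
        refine h2.trans ((add_le_add_left (mul_le_of_le_one_right' h5) _).trans ?_)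
        rw [← ENNReal.ofReal_mul (by positivity), ← ENNReal.ofReal_add (by positivity)
          (by positivity), ← ENNReal.ofReal_add (by positivity) (by positivity)]
        refine ENNReal.ofReal_le_ofReal ?_
        nlinarith
      exact (ENNReal.add_le_add_iff_right ENNReal.ofReal_ne_top).1 h6
    calc ∫⁻ x in A, ENNReal.ofReal |f x| ∂μ
        = ∫⁻ x in A, c * ENNReal.ofReal (|f x| / c) ∂μ := by
          refine lintegral_congr fun x => ?_
          rw [← ENNReal.ofReal_coe_nnreal, ← ENNReal.ofReal_mul c.coe_nonneg]
          congr 1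
          have : (c : ℝ) ≠ 0 := by positivity
          field_simp
      _ = c * ∫⁻ x in A, ENNReal.ofReal (|f x| / c) ∂μ :=
          lintegral_const_mul' _ _ ENNReal.coe_ne_top
      _ ≤ _ := by gcongr
  have hK0 : ENNReal.ofReal (v * m) ≠ 0 := (ENNReal.ofReal_pos.2 hK).ne'
  rw [← ENNReal.div_le_iff hK0 ENNReal.ofReal_ne_top]
  refine le_iInf fun c => le_iInf fun hc => le_iInf fun h => ?_
  rw [ENNReal.div_le_iff hK0 ENNReal.ofReal_ne_top]
  exact key c hc h

/-- Jensen's inequality for `exp (-G)` on a set, in terms of an upper bound for the mean of `G`. -/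
theorem ofReal_mul_exp_neg_le_setLIntegral {α : Type*} [MeasurableSpace α] {μ : Measure α}
    [IsFiniteMeasure μ] {G : α → ℝ} {A : Set α} {m : ℝ}
    (hG : AEMeasurable G (μ.restrict A)) (hG0 : ∀ x, 0 ≤ G x) (hm : 0 ≤ m)
    (h : ∫⁻ x in A, ENNReal.ofReal (G x) ∂μ ≤ ENNReal.ofReal (m * μ.real A)) :
    ENNReal.ofReal (μ.real A * Real.exp (-m)) ≤
      ∫⁻ x in A, ENNReal.ofReal (Real.exp (-G x)) ∂μ := by
  set v := μ.real A with hvdef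
  have hv0 : 0 ≤ v := measureReal_nonneg
  have hμA : μ A = ENNReal.ofReal v := (ofReal_measureReal (measure_ne_top μ A)).symm
  -- The tangent line of `exp (-·)` at `m`, arranged without subtraction so that it can be
  -- integrated in `ℝ≥0∞`.
  have h1 : ∫⁻ x in A, ENNReal.ofReal (Real.exp (-m) * (1 + m)) ∂μ ≤
      ∫⁻ x in A, (ENNReal.ofReal (Real.exp (-G x)) +
        ENNReal.ofReal (Real.exp (-m)) * ENNReal.ofReal (G x)) ∂μ := by
    refine lintegral_mono fun x => ?_
    rw [← ENNReal.ofReal_mul (by positivity), ← ENNReal.ofReal_add (by positivity)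
      (mul_nonneg (Real.exp_pos _).le (hG0 x))]
    refine ENNReal.ofReal_le_ofReal ?_
    have h2 := Real.add_one_le_exp (m - G x)
    have h3 : Real.exp (-G x) = Real.exp (-m) * Real.exp (m - G x) := by
      rw [← Real.exp_add]; congr 1; ring
    rw [h3]
    nlinarith [Real.exp_pos (-m)]
  rw [setLIntegral_const, lintegral_add_right' _ (hG.ennreal_ofReal.const_mul _),
    lintegral_const_mul' _ _ ENNReal.ofReal_ne_top, hμA, ← ENNReal.ofReal_mul (by positivity)] at h1
  have h4 : ENNReal.ofReal (Real.exp (-m)) * ∫⁻ x in A, ENNReal.ofReal (G x) ∂μ ≤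
      ENNReal.ofReal (Real.exp (-m) * (m * v)) := by
    rw [ENNReal.ofReal_mul (by positivity)]
    gcongr
  have h5 : ENNReal.ofReal (v * Real.exp (-m)) + ENNReal.ofReal (Real.exp (-m) * (m * v)) ≤
      ∫⁻ x in A, ENNReal.ofReal (Real.exp (-G x)) ∂μ + ENNReal.ofReal (Real.exp (-m) * (m * v)) := by
    rw [← ENNReal.ofReal_add (by positivity) (by positivity)]
    refine le_trans (le_of_eq ?_) (h1.trans (add_le_add_right h4 _))
    congr 1
    ring
  exact (ENNReal.add_le_add_iff_right ENNReal.ofReal_ne_top).1 h5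

/-! ### The determinant near the identity. -/

/-- The trace of an endomorphism of `ℝⁿ`. -/
noncomputable def eucTrace (n : ℕ) : (Euc n →L[ℝ] Euc n) →L[ℝ] ℝ :=
  ∑ i : Fin n, (EuclideanSpace.proj i).comp
    (ContinuousLinearMap.apply ℝ (Euc n) (EuclideanSpace.single i (1 : ℝ)))

theorem eucTrace_apply {n : ℕ} (M : Euc n →L[ℝ] Euc n) :
    eucTrace n M = ∑ i : Fin n, (M (EuclideanSpace.single i (1 : ℝ))) i := by
  simp [eucTrace]

/-- The determinant of an endomorphism of `ℝⁿ` is that of its matrix. -/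
theorem det_eq_det_matrix {n : ℕ} (M : Euc n →L[ℝ] Euc n) :
    M.det = (Matrix.of fun i j => (M (EuclideanSpace.single j (1 : ℝ))) i).det := by
  have h : LinearMap.toMatrix (EuclideanSpace.basisFun (Fin n) ℝ).toBasis
      (EuclideanSpace.basisFun (Fin n) ℝ).toBasis (M : Euc n →ₗ[ℝ] Euc n) =
      Matrix.of fun i j => (M (EuclideanSpace.single j (1 : ℝ))) i := by
    ext i j
    simp [LinearMap.toMatrix_apply]
  rw [ContinuousLinearMap.det, ← h, LinearMap.det_toMatrix]

/-- The determinant is polynomial in the entries, hence differentiable; its derivative can then be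
read off along lines from `Matrix.det_one_add_smul`. -/
theorem hasFDerivAt_det_one_add (n : ℕ) :
    HasFDerivAt (fun M : Euc n →L[ℝ] Euc n => (1 + M).det) (eucTrace n) 0 := by
  have hd : DifferentiableAt ℝ (fun M : Euc n →L[ℝ] Euc n => (1 + M).det) 0 := by
    simp_rw [det_eq_det_matrix, Matrix.det_apply']
    refine DifferentiableAt.fun_sum fun σ _ => DifferentiableAt.const_mul ?_ _
    refine (contDiff_prod (𝕜 := ℝ) (n := 1) fun i _ => ?_).differentiable one_ne_zero 0
    let L : (Euc n →L[ℝ] Euc n) →L[ℝ] ℝ := (EuclideanSpace.proj (σ i)).comp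
      (ContinuousLinearMap.apply ℝ (Euc n) (EuclideanSpace.single i (1 : ℝ)))
    exact L.contDiff.comp (contDiff_const.add contDiff_id)
  have he : fderiv ℝ (fun M : Euc n →L[ℝ] Euc n => (1 + M).det) 0 = eucTrace n := by
    ext M
    have h1 : HasDerivAt (fun r : ℝ => (1 + r • M).det)
        (fderiv ℝ (fun M : Euc n →L[ℝ] Euc n => (1 + M).det) 0 M) 0 := by
      have h2 : HasDerivAt (fun r : ℝ => r • M) M 0 := by
        simpa using (hasDerivAt_id (0 : ℝ)).smul_const M
      exact hd.hasFDerivAt.comp_hasDerivAt_of_eq (0 : ℝ) h2 (zero_smul ℝ M).symm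
    set N : Matrix (Fin n) (Fin n) ℝ :=
      Matrix.of fun i j => (M (EuclideanSpace.single j (1 : ℝ))) i with hN
    have h4 : (fun r : ℝ => (1 + r • M).det) = fun r : ℝ => (1 + r • N).det := by
      funext r
      rw [det_eq_det_matrix]
      congr 1
      ext i j
      simp [hN, Matrix.one_apply]
    have h5 : HasDerivAt (fun r : ℝ => (1 + r • N).det) N.trace 0 := by
      have h7 : (fun r : ℝ => (1 + r • N).det) = fun r : ℝ => 1 + N.trace * r +
          (Matrix.det (1 + (Polynomial.X : Polynomial ℝ) •
            N.map Polynomial.C)).divX.divX.eval r * r ^ 2 :=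
        funext fun r => Matrix.det_one_add_smul r N
      rw [h7]
      have h6 := (((hasDerivAt_const (0 : ℝ) (1 : ℝ)).add
        ((hasDerivAt_id (0 : ℝ)).const_mul N.trace))).add
        ((Polynomial.hasDerivAt (Matrix.det (1 + (Polynomial.X : Polynomial ℝ) •
          N.map Polynomial.C)).divX.divX (0 : ℝ)).mul (hasDerivAt_pow 2 (0 : ℝ)))
      exact h6.congr_deriv (by simp)
    rw [h4] at h1
    rw [h1.unique h5, eucTrace_apply]
    rfl
  rw [← he]
  exact hd.hasFDerivAt

/-- The first-order expansion of `log det` at the identity. Since the loss is `η ‖M‖`, the losses of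
many small steps add up to `η` times the total mass, whatever their number. -/
theorem exists_exp_trace_sub_le_abs_det (n : ℕ) {η : ℝ} (hη : 0 < η) :
    ∃ ε > 0, ∀ M : Euc n →L[ℝ] Euc n, ‖M‖ ≤ ε →
      Real.exp (eucTrace n M - η * ‖M‖) ≤ |(1 + M).det| := by
  have hdet1 : ((1 : Euc n →L[ℝ] Euc n) + 0).det = 1 := by
    rw [add_zero]; exact LinearMap.det_id
  have h := (hasFDerivAt_det_one_add n).log (by rw [hdet1]; norm_num)
  have h1 := h.isLittleO.def hη
  have h2 : ∀ᶠ M in 𝓝 (0 : Euc n →L[ℝ] Euc n), 0 < (1 + M).det :=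
    (hasFDerivAt_det_one_add n).continuousAt.eventually
      (lt_mem_nhds (by simp only [hdet1]; norm_num))
  obtain ⟨ε, hε, hball⟩ := Metric.nhds_basis_closedBall.mem_iff.1 (h1.and h2)
  refine ⟨ε, hε, fun M hM => ?_⟩
  obtain ⟨h3, h4⟩ := hball (mem_closedBall_zero_iff.2 hM)
  rw [hdet1, Real.log_one, inv_one, one_smul, sub_zero, sub_zero, Real.norm_eq_abs] at h3
  have h5 := (abs_le.1 h3).1
  rw [abs_of_pos h4, ← Real.le_log_iff_exp_le h4]
  linarith

/-! ### Euler steps and their Gaussian Jacobian. -/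

/-- A time-dependent differentiable field which on a ball is bounded and Lipschitz in space, with
constant integrable in time. -/
structure IsLipschitzOnBall {n : ℕ} (b : ℝ → Euc n → Euc n) (R : ℝ) (g : ℝ → ℝ) : Prop where
  measurable : Measurable (Function.uncurry b)
  differentiable : ∀ t, Differentiable ℝ (b t)
  integrable : Integrable g
  nonneg : ∀ t, 0 ≤ g t
  lip : ∀ t x y, ‖x‖ ≤ R → ‖y‖ ≤ R → ‖b t x - b t y‖ ≤ g t * ‖x - y‖
  bound : ∀ t x, ‖x‖ ≤ R → ‖b t x‖ ≤ g t

/-- The Euler step `x ↦ x + ∫ₛᵗ b(r, x) dr`. -/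
noncomputable def eulerStep {n : ℕ} (b : ℝ → Euc n → Euc n) (s t : ℝ) (x : Euc n) : Euc n :=
  x + ∫ r in Ioc s t, b r x

/-- A directional derivative is a limit of difference quotients, which are jointly Borel without any
continuity in time. -/
theorem measurable_fderiv_apply_prod {n : ℕ} {b : ℝ → Euc n → Euc n}
    (hb : Measurable (Function.uncurry b)) (hd : ∀ t, Differentiable ℝ (b t)) (v : Euc n) :
    Measurable fun p : ℝ × Euc n => fderiv ℝ (b p.1) p.2 v := by
  have hlim : ∀ p : ℝ × Euc n, Tendsto (fun k : ℕ => ((k : ℝ) + 1) •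
      (b p.1 (p.2 + ((k : ℝ) + 1)⁻¹ • v) - b p.1 p.2)) atTop (𝓝 (fderiv ℝ (b p.1) p.2 v)) := by
    intro p
    have h1 : Tendsto (fun k : ℕ => ‖(k : ℝ) + 1‖) atTop atTop :=
      tendsto_norm_atTop_atTop.comp (tendsto_atTop_add_const_right _ 1 tendsto_natCast_atTop_atTop)
    exact (hd p.1 p.2).hasFDerivAt.lim v h1
  refine measurable_of_tendsto_metrizable (fun k => ?_) (tendsto_pi_nhds.2 hlim)
  have h2 : Measurable fun p : ℝ × Euc n => b p.1 (p.2 + ((k : ℝ) + 1)⁻¹ • v) :=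
    hb.comp (measurable_fst.prodMk (measurable_snd.add_const _))
  exact (h2.sub hb).const_smul ((k : ℝ) + 1)

theorem measurable_gaussDiv_prod {n : ℕ} {b : ℝ → Euc n → Euc n}
    (hb : Measurable (Function.uncurry b)) (hd : ∀ t, Differentiable ℝ (b t)) :
    Measurable fun p : ℝ × Euc n => gaussDiv (b p.1) p.2 := by
  unfold gaussDiv divergence
  refine Measurable.sub (Finset.measurable_sum _ fun i _ => ?_) (measurable_snd.inner hb)
  exact (EuclideanSpace.proj i : Euc n →L[ℝ] ℝ).measurable.comp
    (measurable_fderiv_apply_prod hb hd _)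

theorem measurable_abs_gaussDiv_prod {n : ℕ} {b : ℝ → Euc n → Euc n}
    (hb : Measurable (Function.uncurry b)) (hd : ∀ t, Differentiable ℝ (b t)) :
    Measurable fun p : Euc n × ℝ => |gaussDiv (b p.2) p.1| := by
  have h : Measurable fun p : Euc n × ℝ => gaussDiv (b p.2) p.1 :=
    (measurable_gaussDiv_prod hb hd).comp (measurable_snd.prodMk measurable_fst)
  exact continuous_abs.measurable.comp h

theorem stronglyMeasurable_fderiv_time {n : ℕ} {b : ℝ → Euc n → Euc n}
    (hb : Measurable (Function.uncurry b)) (hd : ∀ t, Differentiable ℝ (b t)) (x : Euc n) :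
    StronglyMeasurable fun t => fderiv ℝ (b t) x := by
  have h : (fun t => fderiv ℝ (b t) x) = fun t => ∑ i : Fin n,
      ContinuousLinearMap.smulRightL ℝ (Euc n) (Euc n) (EuclideanSpace.proj i)
        (fderiv ℝ (b t) x (EuclideanSpace.single i (1 : ℝ))) := by
    funext t
    ext1 y
    have hy : y = ∑ i : Fin n, y i • EuclideanSpace.single i (1 : ℝ) := by
      have := (EuclideanSpace.basisFun (Fin n) ℝ).sum_repr y
      simpa using this.symm
    conv_lhs => rw [hy]
    rw [map_sum]
    simp
  rw [h]
  refine Finset.stronglyMeasurable_fun_sum _ fun i _ => ?_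
  refine (ContinuousLinearMap.continuous _).comp_stronglyMeasurable ?_
  exact ((measurable_fderiv_apply_prod hb hd _).comp
    (measurable_id.prodMk measurable_const)).stronglyMeasurable

namespace IsLipschitzOnBall

variable {n : ℕ} {b : ℝ → Euc n → Euc n} {R : ℝ} {g : ℝ → ℝ}

theorem integrable_apply (hb : IsLipschitzOnBall b R g) {x : Euc n} (hx : ‖x‖ ≤ R) :
    Integrable fun r => b r x :=
  hb.integrable.mono'
    (hb.measurable.comp (measurable_id.prodMk measurable_const)).aestronglyMeasurable
    (Eventually.of_forall fun r => hb.bound r x hx)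

theorem norm_fderiv_le (hb : IsLipschitzOnBall b R g) (t : ℝ) {x : Euc n} (hx : ‖x‖ < R) :
    ‖fderiv ℝ (b t) x‖ ≤ g t := by
  have hnhds : Metric.ball (0 : Euc n) R ∈ 𝓝 x :=
    Metric.isOpen_ball.mem_nhds (mem_ball_zero_iff.2 hx)
  have hl : LipschitzOnWith ⟨g t, hb.nonneg t⟩ (b t) (Metric.ball 0 R) :=
    LipschitzOnWith.of_dist_le_mul fun y hy z hz => by
      rw [dist_eq_norm, dist_eq_norm]
      exact hb.lip t y z (mem_ball_zero_iff.1 hy).le (mem_ball_zero_iff.1 hz).le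
  exact (hb.differentiable t x).hasFDerivAt.le_of_lipschitzOn hnhds hl

theorem integrable_fderiv (hb : IsLipschitzOnBall b R g) {x : Euc n} (hx : ‖x‖ < R) :
    Integrable fun r => fderiv ℝ (b r) x :=
  hb.integrable.mono'
    (stronglyMeasurable_fderiv_time hb.measurable hb.differentiable x).aestronglyMeasurable
    (Eventually.of_forall fun r => hb.norm_fderiv_le r hx)

theorem hasFDerivAt_eulerStep (hb : IsLipschitzOnBall b R g) (s t : ℝ) {x : Euc n}
    (hx : ‖x‖ < R) :
    HasFDerivAt (eulerStep b s t) (1 + ∫ r in Ioc s t, fderiv ℝ (b r) x) x := by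
  have hnhds : Metric.ball (0 : Euc n) R ∈ 𝓝 x :=
    Metric.isOpen_ball.mem_nhds (mem_ball_zero_iff.2 hx)
  refine (hasFDerivAt_id x).add ?_
  refine hasFDerivAt_integral_of_dominated_of_fderiv_le (F := fun x r => b r x)
    (F' := fun x r => fderiv ℝ (b r) x) (bound := g) hnhds ?_
    (hb.integrable_apply hx.le).integrableOn (hb.integrable_fderiv hx).aestronglyMeasurable.restrict
    (Eventually.of_forall fun r y hy => hb.norm_fderiv_le r (mem_ball_zero_iff.1 hy))
    hb.integrable.integrableOn
    (Eventually.of_forall fun r y _ => (hb.differentiable r y).hasFDerivAt)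
  exact Eventually.of_forall fun y =>
    (hb.measurable.comp (measurable_id.prodMk measurable_const)).aestronglyMeasurable

theorem injOn_eulerStep (hb : IsLipschitzOnBall b R g) {s t : ℝ}
    (hκ : ∫ r in Ioc s t, g r < 1) : InjOn (eulerStep b s t) (Metric.ball 0 R) := by
  intro x hx y hy hxy
  have hx' := (mem_ball_zero_iff.1 hx).le
  have hy' := (mem_ball_zero_iff.1 hy).le
  have h1 : x - y = -∫ r in Ioc s t, (b r x - b r y) := by
    rw [integral_sub (hb.integrable_apply hx').integrableOn (hb.integrable_apply hy').integrableOn]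
    unfold eulerStep at hxy
    rw [neg_sub, sub_eq_sub_iff_add_eq_add, hxy]
    abel
  have h2 : ‖x - y‖ ≤ (∫ r in Ioc s t, g r) * ‖x - y‖ := by
    conv_lhs => rw [h1, norm_neg]
    rw [← integral_mul_const]
    exact norm_integral_le_of_norm_le (hb.integrable.mul_const _).integrableOn
      (Eventually.of_forall fun r => hb.lip r x y hx' hy')
  by_contra hne
  have h3 : 0 < ‖x - y‖ := norm_pos_iff.2 (sub_ne_zero.2 hne)
  nlinarith

theorem integrable_gaussDiv (hb : IsLipschitzOnBall b R g) {x : Euc n} (hx : ‖x‖ < R) :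
    Integrable fun r => gaussDiv (b r) x := by
  have h1 := (eucTrace n).integrable_comp (hb.integrable_fderiv hx)
  have h2 := (hb.integrable_apply hx.le).const_inner (𝕜 := ℝ) x
  simp only [eucTrace_apply] at h1
  exact h1.sub h2

/-- The right side is the first-order part of the logarithm of the Gaussian Jacobian of an Euler
step: a trace from the determinant and an inner product from the Gaussian weight. -/
theorem setIntegral_gaussDiv (hb : IsLipschitzOnBall b R g) (s t : ℝ) {x : Euc n} (hx : ‖x‖ < R) :
    ∫ r in Ioc s t, gaussDiv (b r) x = eucTrace n (∫ r in Ioc s t, fderiv ℝ (b r) x) -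
      inner ℝ x (∫ r in Ioc s t, b r x) := by
  have h0 := (hb.integrable_fderiv hx).integrableOn (s := Ioc s t)
  have h1 := (eucTrace n).integrable_comp h0
  have h2 := (hb.integrable_apply hx.le).integrableOn (s := Ioc s t)
  rw [← ContinuousLinearMap.integral_comp_comm _ h0, ← integral_inner h2,
    ← integral_sub h1 (h2.const_inner x)]
  simp only [eucTrace_apply]
  rfl

/-- Lower bound for the Gaussian Jacobian of an Euler step. -/
theorem gaussPDF_mul_exp_le (hb : IsLipschitzOnBall b R g) {s t η ε : ℝ} (hη : 0 ≤ η)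
    (hdet : ∀ M : Euc n →L[ℝ] Euc n, ‖M‖ ≤ ε →
      Real.exp (eucTrace n M - η * ‖M‖) ≤ |(1 + M).det|)
    (hκ : ∫ r in Ioc s t, g r ≤ ε) {x : Euc n} (hx : ‖x‖ < R) :
    Real.exp (-((∫ r in Ioc s t, |gaussDiv (b r) x|) + (η * (∫ r in Ioc s t, g r) +
      (∫ r in Ioc s t, g r) ^ 2 / 2))) * gaussPDF n x ≤
      |(1 + ∫ r in Ioc s t, fderiv ℝ (b r) x).det| * gaussPDF n (eulerStep b s t x) := by
  set κ := ∫ r in Ioc s t, g r with hκdef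
  set M := ∫ r in Ioc s t, fderiv ℝ (b r) x with hM
  set h := ∫ r in Ioc s t, b r x with hh
  have hMκ : ‖M‖ ≤ κ := norm_integral_le_of_norm_le hb.integrable.integrableOn
    (Eventually.of_forall fun r => hb.norm_fderiv_le r hx)
  have hhκ : ‖h‖ ≤ κ := norm_integral_le_of_norm_le hb.integrable.integrableOn
    (Eventually.of_forall fun r => hb.bound r x hx.le)
  have h1 := hdet M (hMκ.trans hκ)
  have h2 := hb.setIntegral_gaussDiv s t hx
  rw [← hM, ← hh] at h2
  have h3 : -(∫ r in Ioc s t, |gaussDiv (b r) x|) ≤ ∫ r in Ioc s t, gaussDiv (b r) x :=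
    (abs_le.1 (abs_integral_le_integral_abs)).1
  have h4 : ‖x + h‖ ^ 2 = ‖x‖ ^ 2 + 2 * inner ℝ x h + ‖h‖ ^ 2 := norm_add_sq_real x h
  have h5 : ‖h‖ ^ 2 ≤ κ ^ 2 := by gcongr
  have h6 : η * ‖M‖ ≤ η * κ := by gcongr
  have h7 : gaussPDF n (eulerStep b s t x) =
      Real.exp (-(inner ℝ x h + ‖h‖ ^ 2 / 2)) * gaussPDF n x := by
    unfold gaussPDF eulerStep
    rw [← hh, h4, mul_left_comm, ← Real.exp_add]
    congr 2
    ring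
  rw [h7, ← mul_assoc]
  refine mul_le_mul_of_nonneg_right ?_ (gaussPDF_pos n x).le
  calc _ ≤ Real.exp (eucTrace n M - η * ‖M‖) * Real.exp (-(inner ℝ x h + ‖h‖ ^ 2 / 2)) := by
        rw [← Real.exp_add]
        exact Real.exp_le_exp.2 (by linarith)
    _ ≤ _ := by gcongr

/-- An Euler step does not decrease the Gaussian measure of a set `A` by more than a power of it,
up to an error that is small compared with the length of the step. -/
theorem log_measure_image_eulerStep_le (hb : IsLipschitzOnBall b R g) {s t η ε : ℝ} (hη : 0 ≤ η)
    (hdet : ∀ M : Euc n →L[ℝ] Euc n, ‖M‖ ≤ ε →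
      Real.exp (eucTrace n M - η * ‖M‖) ≤ |(1 + M).det|)
    (hκ : ∫ r in Ioc s t, g r ≤ ε) (hε : ε < 1)
    (hβ : ∫⁻ r in Ioc s t, expNorm (gaussDiv (b r)) ≠ ∞) {A : Set (Euc n)}
    (hA : MeasurableSet A) (hAR : A ⊆ Metric.ball 0 R) (hA0 : 0 < (gaussMeasure n).real A) :
    0 < (gaussMeasure n).real (eulerStep b s t '' A) ∧
    Real.log (2 / (gaussMeasure n).real (eulerStep b s t '' A)) ≤
      Real.log (2 / (gaussMeasure n).real A) * (1 + expDivIntegral b s t) +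
        (η * (∫ r in Ioc s t, g r) + (∫ r in Ioc s t, g r) ^ 2 / 2) := by
  set κ := ∫ r in Ioc s t, g r with hκdef
  set v := (gaussMeasure n).real A with hv
  set L := Real.log (2 / v) with hL
  set δ := η * κ + κ ^ 2 / 2 with hδ
  set β := expDivIntegral b s t with hβdef
  have hκ0 : 0 ≤ κ := integral_nonneg fun r => hb.nonneg r
  have hδ0 : 0 ≤ δ := by positivity
  have hβ0 : 0 ≤ β := ENNReal.toReal_nonneg
  have hv1 : v ≤ 1 := measureReal_le_one
  have hL0 : 0 ≤ L := Real.log_nonneg (by rw [le_div_iff₀ hA0]; linarith)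
  have hgm := measurable_abs_gaussDiv_prod hb.measurable hb.differentiable
  set G : Euc n → ℝ := fun x => (∫ r in Ioc s t, |gaussDiv (b r) x|) + δ with hG
  have hGm : Measurable G := by
    refine Measurable.add_const ?_ _
    exact (hgm.stronglyMeasurable.integral_prod_right'
      (ν := (volume : Measure ℝ).restrict (Ioc s t))).measurable
  have hG0 : ∀ x, 0 ≤ G x := fun x => add_nonneg (integral_nonneg fun r => abs_nonneg _) hδ0
  -- As `x` is frozen during the step, after exchanging integrals the Orlicz bound is used at every
  -- time on the same set `A`, so `β L + δ` bounds the mean of `G` for Jensen's inequality.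
  have hGint : ∫⁻ x in A, ENNReal.ofReal (G x) ∂(gaussMeasure n) ≤
      ENNReal.ofReal ((β * L + δ) * v) := by
    calc ∫⁻ x in A, ENNReal.ofReal (G x) ∂(gaussMeasure n)
        = ∫⁻ x in A, ((∫⁻ r in Ioc s t, ENNReal.ofReal |gaussDiv (b r) x|) + ENNReal.ofReal δ)
            ∂(gaussMeasure n) := by
          refine setLIntegral_congr_fun hA fun x hx => ?_
          have hxR := mem_ball_zero_iff.1 (hAR hx)
          simp only [hG]
          rw [ENNReal.ofReal_add (integral_nonneg fun r => abs_nonneg _) hδ0,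
            ofReal_integral_eq_lintegral_ofReal (hb.integrable_gaussDiv hxR).abs.integrableOn
            (Eventually.of_forall fun r => abs_nonneg _)]
      _ = (∫⁻ r in Ioc s t, ∫⁻ x in A, ENNReal.ofReal |gaussDiv (b r) x| ∂(gaussMeasure n)) +
            ENNReal.ofReal (δ * v) := by
          rw [lintegral_add_right _ measurable_const, setLIntegral_const,
            ← ofReal_measureReal (measure_ne_top _ A), ← ENNReal.ofReal_mul hδ0]
          congr 1
          refine lintegral_lintegral_swap ?_
          exact hgm.ennreal_ofReal.aemeasurable
      _ ≤ (∫⁻ r in Ioc s t, expNorm (gaussDiv (b r)) * ENNReal.ofReal (v * L)) +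
            ENNReal.ofReal (δ * v) := by
          gcongr with r
          exact setLIntegral_abs_le_luxemburgNorm_mul _ hA0
      _ = ENNReal.ofReal ((β * L + δ) * v) := by
          rw [lintegral_mul_const' _ _ ENNReal.ofReal_ne_top, ← ENNReal.ofReal_toReal hβ,
            ← ENNReal.ofReal_mul ENNReal.toReal_nonneg, ← ENNReal.ofReal_add (by positivity)
            (by positivity)]
          congr 1
          change β * (v * L) + δ * v = _
          ring
  have hJ := ofReal_mul_exp_neg_le_setLIntegral hGm.aemeasurable hG0
    (by positivity : 0 ≤ β * L + δ) hGint
  have himg : ∫⁻ x in A, ENNReal.ofReal (Real.exp (-G x)) ∂(gaussMeasure n) ≤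
      gaussMeasure n (eulerStep b s t '' A) := by
    have hfd : ∀ x ∈ A, HasFDerivWithinAt (eulerStep b s t)
        (1 + ∫ r in Ioc s t, fderiv ℝ (b r) x) A x := fun x hx =>
      (hb.hasFDerivAt_eulerStep s t (mem_ball_zero_iff.1 (hAR hx))).hasFDerivWithinAt
    have hinj : InjOn (eulerStep b s t) A := (hb.injOn_eulerStep (hκ.trans_lt hε)).mono hAR
    rw [gaussMeasure_eq, withDensity_apply _ (measurable_image_of_fderivWithin hA hfd hinj),
      lintegral_image_eq_lintegral_abs_det_fderiv_mul _ hA hfd hinj,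
      setLIntegral_withDensity_eq_setLIntegral_mul _ (measurable_gaussPDF n)
        (by fun_prop) hA]
    refine setLIntegral_mono' hA fun x hx => ?_
    rw [Pi.mul_apply, ← ENNReal.ofReal_mul (gaussPDF_pos n x).le,
      ← ENNReal.ofReal_mul (abs_nonneg _), mul_comm]
    exact ENNReal.ofReal_le_ofReal
      (hb.gaussPDF_mul_exp_le hη hdet hκ (mem_ball_zero_iff.1 (hAR hx)))
  have hfin : v * Real.exp (-(β * L + δ)) ≤ (gaussMeasure n).real (eulerStep b s t '' A) := by
    have := hJ.trans himg
    rwa [← ofReal_measureReal (measure_ne_top _ _),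
      ENNReal.ofReal_le_ofReal_iff measureReal_nonneg] at this
  have hpos : 0 < v * Real.exp (-(β * L + δ)) := by positivity
  refine ⟨hpos.trans_le hfin, ?_⟩
  calc Real.log (2 / (gaussMeasure n).real (eulerStep b s t '' A))
      ≤ Real.log (2 / (v * Real.exp (-(β * L + δ)))) := by
        refine Real.log_le_log (by have := hpos.trans_le hfin; positivity) ?_
        gcongr
    _ = L + (β * L + δ) := by
        rw [← div_div, Real.log_div (by positivity) (by positivity), Real.log_exp]
        ring
    _ = L * (1 + β) + δ := by ring

end IsLipschitzOnBall

/-! ### Iterated Euler steps and passage to the flow. -/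

theorem expDivIntegral_add {n : ℕ} {b : ℝ → Euc n → Euc n} {r s t : ℝ} (hrs : r ≤ s) (hst : s ≤ t)
    (h : ∫⁻ τ in Ioc r t, expNorm (gaussDiv (b τ)) ≠ ∞) :
    expDivIntegral b r t = expDivIntegral b r s + expDivIntegral b s t := by
  have e : ∫⁻ τ in Ioc r t, expNorm (gaussDiv (b τ)) =
      (∫⁻ τ in Ioc r s, expNorm (gaussDiv (b τ))) + ∫⁻ τ in Ioc s t, expNorm (gaussDiv (b τ)) := by
    rw [← Ioc_union_Ioc_eq_Ioc hrs hst]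
    refine lintegral_union measurableSet_Ioc ?_
    exact Set.disjoint_left.2 fun x hx hx' => absurd hx.2 (not_le.2 hx'.1)
  rw [e, ENNReal.add_ne_top] at h
  unfold expDivIntegral
  rw [e, ENNReal.toReal_add h.1 h.2]

theorem setIntegral_Ioc_add {E : Type*} [NormedAddCommGroup E] [NormedSpace ℝ E] {g : ℝ → E}
    {r s t : ℝ} (hrs : r ≤ s) (hst : s ≤ t) (hg : IntegrableOn g (Ioc r t)) :
    ∫ τ in Ioc r t, g τ = (∫ τ in Ioc r s, g τ) + ∫ τ in Ioc s t, g τ := by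
  rw [← Ioc_union_Ioc_eq_Ioc hrs hst]
  refine setIntegral_union ?_ measurableSet_Ioc (hg.mono_set (Ioc_subset_Ioc_right hst))
    (hg.mono_set (Ioc_subset_Ioc_left hrs))
  exact Set.disjoint_left.2 fun x hx hx' => absurd hx.2 (not_le.2 hx'.1)

theorem IsTrajectory.eq_add_setIntegral {n : ℕ} {b : ℝ → Euc n → Euc n} {T s r t : ℝ} {x : Euc n}
    {γ : ℝ → Euc n} (h : IsTrajectory b T s x γ) (hsr : s ≤ r) (hrt : r ≤ t) (htT : t ≤ T) :
    IntegrableOn (fun τ => b τ (γ τ)) (Ioc r t) ∧ γ t = γ r + ∫ τ in Ioc r t, b τ (γ τ) := by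
  have hi : IntegrableOn (fun τ => b τ (γ τ)) (Ioc s t) :=
    h.integrable.1.mono_set (Ioc_subset_Ioc_right htT)
  refine ⟨hi.mono_set (Ioc_subset_Ioc_left hsr), ?_⟩
  rw [h.eq_integral t ⟨hsr.trans hrt, htT⟩, h.eq_integral r ⟨hsr, hrt.trans htT⟩,
    intervalIntegral.integral_of_le (hsr.trans hrt), intervalIntegral.integral_of_le hsr,
    setIntegral_Ioc_add hsr hrt hi, add_assoc]

namespace IsLipschitzOnBall

variable {n : ℕ} {b : ℝ → Euc n → Euc n} {R : ℝ} {g : ℝ → ℝ}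

/-- One step of the error estimate for Euler's method. -/
theorem norm_eulerStep_sub_le (hb : IsLipschitzOnBall b R g) {s r t T : ℝ} {x y : Euc n}
    {γ : ℝ → Euc n} (hγ : IsTrajectory b T s x γ) (hγR : ∀ τ ∈ Icc s T, ‖γ τ‖ ≤ R)
    (hsr : s ≤ r) (hrt : r ≤ t) (htT : t ≤ T) (hy : ‖y‖ ≤ R) :
    ‖eulerStep b r t y - γ t‖ ≤ ‖y - γ r‖ * (1 + ∫ τ in Ioc r t, g τ) +
      (∫ τ in Ioc r t, g τ) ^ 2 := by
  set κ := ∫ τ in Ioc r t, g τ with hκ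
  obtain ⟨hi, he⟩ := hγ.eq_add_setIntegral hsr hrt htT
  have hdist : ∀ τ ∈ Ioc r t, ‖γ τ - γ r‖ ≤ κ := fun τ hτ => by
    obtain ⟨-, he'⟩ := hγ.eq_add_setIntegral hsr hτ.1.le (hτ.2.trans htT)
    rw [he', add_sub_cancel_left]
    refine (norm_integral_le_of_norm_le (hb.integrable.integrableOn (s := Ioc r τ)) ?_).trans
      (setIntegral_mono_set hb.integrable.integrableOn (Eventually.of_forall hb.nonneg)
        (Ioc_subset_Ioc_right hτ.2).eventuallyLE)
    rw [ae_restrict_iff' measurableSet_Ioc]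
    exact Eventually.of_forall fun σ hσ => hb.bound σ _
      (hγR σ ⟨hsr.trans hσ.1.le, hσ.2.trans (hτ.2.trans htT)⟩)
  have e : eulerStep b r t y - γ t =
      (y - γ r) + ∫ τ in Ioc r t, (b τ y - b τ (γ τ)) := by
    rw [integral_sub (hb.integrable_apply hy).integrableOn hi, he]
    unfold eulerStep
    abel
  rw [e]
  have h1 : ‖∫ τ in Ioc r t, (b τ y - b τ (γ τ))‖ ≤ κ * (‖y - γ r‖ + κ) := by
    rw [hκ, ← integral_mul_const, ← hκ]
    refine norm_integral_le_of_norm_le (hb.integrable.mul_const _).integrableOn ?_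
    rw [ae_restrict_iff' measurableSet_Ioc]
    refine Eventually.of_forall fun τ hτ => ?_
    refine (hb.lip τ y (γ τ) hy (hγR τ ⟨hsr.trans hτ.1.le, hτ.2.trans htT⟩)).trans ?_
    refine mul_le_mul_of_nonneg_left ?_ (hb.nonneg τ)
    calc ‖y - γ τ‖ = ‖(y - γ r) - (γ τ - γ r)‖ := by congr 1; abel
      _ ≤ ‖y - γ r‖ + ‖γ τ - γ r‖ := norm_sub_le _ _
      _ ≤ _ := by gcongr; exact hdist τ hτ
  calc _ ≤ ‖y - γ r‖ + κ * (‖y - γ r‖ + κ) := (norm_add_le _ _).trans (by gcongr)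
    _ = _ := by ring

/-- `Y` approximates the flow on `A` up to time `r`, and controls the Gaussian measure of the
image of `A`. -/
structure IsEulerApprox (b : ℝ → Euc n → Euc n) (g : ℝ → ℝ) (A : Set (Euc n))
    (γ : Euc n → ℝ → Euc n) (s ε η r : ℝ) (Y : Euc n → Euc n) : Prop where
  continuousOn : ContinuousOn Y A
  error : ∀ x ∈ A, ‖Y x - γ x r‖ ≤
    ε * (∫ τ in Ioc s r, g τ) * Real.exp (∫ τ in Ioc s r, g τ)
  measure_pos : 0 < (gaussMeasure n).real (Y '' A)
  log_measure : Real.log (2 / (gaussMeasure n).real (Y '' A)) ≤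
    Real.exp (expDivIntegral b s r) * (Real.log (2 / (gaussMeasure n).real A) +
      2 * η * ∫ τ in Ioc s r, g τ)

variable {A : Set (Euc n)} {γ : Euc n → ℝ → Euc n} {s T ε η : ℝ}

/-- A discrete Grönwall argument, with `1 + κ ≤ exp κ` and `1 + β ≤ exp β`. Here `κ² ≤ ε κ` makes
the quadratic errors summable, and `ε ≤ 2 η` absorbs `κ² / 2` into `η κ`. The smallness condition on
`ε` keeps `Y` within distance `1` of the trajectories, so in the ball of radius `R` where the
estimates hold. -/
theorem IsEulerApprox.step (hb : IsLipschitzOnBall b R g) (hA : IsCompact A)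
    (hγ : ∀ x ∈ A, IsTrajectory b T s x (γ x))
    (hγR : ∀ x ∈ A, ∀ τ ∈ Icc s T, ‖γ x τ‖ ≤ R - 1)
    (hβ : ∫⁻ τ in Ioc s T, expNorm (gaussDiv (b τ)) ≠ ∞) (hη : 0 < η)
    (hdet : ∀ M : Euc n →L[ℝ] Euc n, ‖M‖ ≤ ε →
      Real.exp (eucTrace n M - η * ‖M‖) ≤ |(1 + M).det|)
    (hε0 : 0 < ε) (hε1 : ε < 1) (hεη : ε ≤ 2 * η)
    (hεG : ε * (∫ τ, g τ) * Real.exp (∫ τ, g τ) < 1)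
    {r t : ℝ} (hsr : s ≤ r) (hrt : r ≤ t) (htT : t ≤ T) (hκ : ∫ τ in Ioc r t, g τ ≤ ε)
    {Y : Euc n → Euc n} (hY : IsEulerApprox b g A γ s ε η r Y) :
    IsEulerApprox b g A γ s ε η t (eulerStep b r t ∘ Y) := by
  set κ := ∫ τ in Ioc r t, g τ with hκdef
  set G := ∫ τ in Ioc s r, g τ with hG
  have hGt : ∫ τ in Ioc s t, g τ = G + κ := setIntegral_Ioc_add hsr hrt hb.integrable.integrableOn
  have hκ0 : 0 ≤ κ := integral_nonneg hb.nonneg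
  have hG0 : 0 ≤ G := integral_nonneg hb.nonneg
  have hGle : G ≤ ∫ τ, g τ := setIntegral_le_integral hb.integrable (Eventually.of_forall hb.nonneg)
  have hYR : ∀ x ∈ A, ‖Y x‖ < R := fun x hx => by
    have h1 := hY.error x hx
    have h2 := hγR x hx r ⟨hsr, hrt.trans htT⟩
    have h0 : 0 ≤ ∫ τ, g τ := hG0.trans hGle
    have h3 : ε * G * Real.exp G ≤ ε * (∫ τ, g τ) * Real.exp (∫ τ, g τ) := by gcongr
    have h4 : ‖Y x‖ ≤ ‖Y x - γ x r‖ + ‖γ x r‖ := by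
      simpa using norm_add_le (Y x - γ x r) (γ x r)
    linarith
  have hYA : Y '' A ⊆ Metric.ball 0 R := by
    rintro _ ⟨x, hx, rfl⟩
    exact mem_ball_zero_iff.2 (hYR x hx)
  have hfin : ∀ {u v : ℝ}, s ≤ u → v ≤ T → ∫⁻ τ in Ioc u v, expNorm (gaussDiv (b τ)) ≠ ∞ :=
    fun hu hv => ne_top_of_le_ne_top hβ (lintegral_mono_set (Ioc_subset_Ioc hu hv))
  obtain ⟨h1, h2⟩ := hb.log_measure_image_eulerStep_le hη.le hdet hκ hε1 (hfin hsr htT)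
    (hA.image_of_continuousOn hY.continuousOn).measurableSet hYA hY.measure_pos
  rw [← image_comp] at h1 h2
  have hκε : κ ^ 2 ≤ ε * κ := by nlinarith
  refine ⟨?_, fun x hx => ?_, h1, h2.trans ?_⟩
  · refine ContinuousOn.comp (t := Metric.ball 0 R) (fun y hy => ?_) hY.continuousOn
      (mapsTo_iff_image_subset.2 hYA)
    exact (hb.hasFDerivAt_eulerStep r t
      (mem_ball_zero_iff.1 hy)).continuousAt.continuousWithinAt
  · rw [hGt]
    have h3 := hb.norm_eulerStep_sub_le (hγ x hx)
      (fun τ hτ => (hγR x hx τ hτ).trans (by linarith)) hsr hrt htT (hYR x hx).le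
    refine h3.trans ?_
    have h4 := hY.error x hx
    have h5 : 1 + κ ≤ Real.exp κ := by linarith [Real.add_one_le_exp κ]
    have h6 : 1 ≤ Real.exp (G + κ) := Real.one_le_exp (by positivity)
    calc ‖Y x - γ x r‖ * (1 + κ) + κ ^ 2
        ≤ (ε * G * Real.exp G) * Real.exp κ + (ε * κ) * Real.exp (G + κ) := by
          gcongr
          exact hκε.trans (le_mul_of_one_le_right (by positivity) h6)
      _ = _ := by rw [Real.exp_add]; ring
  · rw [hGt, expDivIntegral_add hsr hrt (hfin le_rfl htT)]
    set β := expDivIntegral b r t with hβdef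
    set B := expDivIntegral b s r with hB
    have hβ0 : 0 ≤ β := ENNReal.toReal_nonneg
    have hB0 : 0 ≤ B := ENNReal.toReal_nonneg
    have hL0 : 0 ≤ Real.log (2 / (gaussMeasure n).real (Y '' A)) := by
      refine Real.log_nonneg ?_
      rw [le_div_iff₀ hY.measure_pos]
      linarith [measureReal_le_one (μ := gaussMeasure n) (s := Y '' A)]
    set L := Real.log (2 / (gaussMeasure n).real (Y '' A)) with hL
    set L0 := Real.log (2 / (gaussMeasure n).real A) with hL0def
    have h5 : 1 + β ≤ Real.exp β := by linarith [Real.add_one_le_exp β]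
    have h6 : 1 ≤ Real.exp (B + β) := Real.one_le_exp (by positivity)
    have h7 : η * κ + κ ^ 2 / 2 ≤ 2 * η * κ := by nlinarith
    have h8 := hY.log_measure
    calc L * (1 + β) + (η * κ + κ ^ 2 / 2)
        ≤ (Real.exp B * (L0 + 2 * η * G)) * Real.exp β + Real.exp (B + β) * (2 * η * κ) := by
          have h9 : L * (1 + β) ≤ (Real.exp B * (L0 + 2 * η * G)) * Real.exp β :=
            (mul_le_mul_of_nonneg_left h5 hL0).trans
              (mul_le_mul_of_nonneg_right h8 (Real.exp_pos β).le)
          have h10 : η * κ + κ ^ 2 / 2 ≤ Real.exp (B + β) * (2 * η * κ) :=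
            h7.trans (le_mul_of_one_le_left (by positivity) h6)
          linarith
      _ = _ := by rw [Real.exp_add]; ring

theorem exists_isEulerApprox (hb : IsLipschitzOnBall b R g) (hA : IsCompact A)
    (hA0 : 0 < (gaussMeasure n).real A)
    (hγ : ∀ x ∈ A, IsTrajectory b T s x (γ x))
    (hγR : ∀ x ∈ A, ∀ τ ∈ Icc s T, ‖γ x τ‖ ≤ R - 1)
    (hβ : ∫⁻ τ in Ioc s T, expNorm (gaussDiv (b τ)) ≠ ∞) (hη : 0 < η)
    (hdet : ∀ M : Euc n →L[ℝ] Euc n, ‖M‖ ≤ ε →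
      Real.exp (eucTrace n M - η * ‖M‖) ≤ |(1 + M).det|)
    (hε0 : 0 < ε) (hε1 : ε < 1) (hεη : ε ≤ 2 * η)
    (hεG : ε * (∫ τ, g τ) * Real.exp (∫ τ, g τ) < 1) (hsT : s ≤ T) :
    ∃ Y, IsEulerApprox b g A γ s ε η T Y := by
  have hstart : IsEulerApprox b g A γ s ε η s id := by
    refine ⟨continuousOn_id, fun x hx => ?_, by rwa [image_id], ?_⟩
    · rw [(hγ x hx).eq_integral s ⟨le_rfl, hsT⟩]
      simp
    · simp [expDivIntegral]
  have key : ∀ k : ℕ, ∀ r ∈ Icc s T, ∫ τ in Ioc s r, g τ ≤ k * ε →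
      ∃ Y, IsEulerApprox b g A γ s ε η r Y := by
    intro k
    induction k with
    | zero =>
      intro r hr hle
      rw [Nat.cast_zero, zero_mul] at hle
      -- Time may pass while `g` has no mass, so even this case takes one Euler step.
      exact ⟨_, IsEulerApprox.step hb hA hγ hγR hβ hη hdet hε0 hε1 hεη hεG le_rfl hr.1 hr.2
        (hle.trans hε0.le) hstart⟩
    | succ k ih =>
      intro r hr hle
      push_cast at hle
      have hcont : ContinuousOn (fun r => ∫ τ in Ioc s r, g τ) (Icc s r) :=
        intervalIntegral.continuousOn_primitive hb.integrable.integrableOn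
      have hGr0 : 0 ≤ ∫ τ in Ioc s r, g τ := integral_nonneg hb.nonneg
      -- Steps are cut by the mass of `g`, not by duration: the last step carries mass at most `ε`,
      -- and what precedes it is left to the induction.
      obtain ⟨r', hr', he⟩ := intermediate_value_Icc hr.1 hcont
        (show max 0 ((∫ τ in Ioc s r, g τ) - ε) ∈ _ by
          simp only [Ioc_self, Measure.restrict_empty, integral_zero_measure]
          exact ⟨le_max_left _ _, max_le hGr0 (by linarith)⟩)
      have he' : ∫ τ in Ioc s r', g τ = max 0 ((∫ τ in Ioc s r, g τ) - ε) := he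
      obtain ⟨Y, hY⟩ := ih r' ⟨hr'.1, hr'.2.trans hr.2⟩ (by
        rw [he']
        exact max_le (by positivity) (by linarith))
      refine ⟨_, IsEulerApprox.step hb hA hγ hγR hβ hη hdet hε0 hε1 hεη hεG hr'.1 hr'.2 hr.2 ?_ hY⟩
      have h1 := setIntegral_Ioc_add hr'.1 hr'.2 hb.integrable.integrableOn
      have h2 := le_max_right 0 ((∫ τ in Ioc s r, g τ) - ε)
      linarith
  obtain ⟨k, hk⟩ := exists_nat_ge ((∫ τ in Ioc s T, g τ) / ε)
  exact key k T ⟨hsT, le_rfl⟩ ((div_le_iff₀ hε0).1 hk)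

/-- Lower bound for the Gaussian measure of the image of a compact set under the flow. -/
theorem two_mul_exp_le_measure_image (hb : IsLipschitzOnBall b R g) (hA : IsCompact A)
    (hA0 : 0 < (gaussMeasure n).real A)
    (hγ : ∀ x ∈ A, IsTrajectory b T s x (γ x))
    (hγR : ∀ x ∈ A, ∀ τ ∈ Icc s T, ‖γ x τ‖ ≤ R - 1)
    (hβ : ∫⁻ τ in Ioc s T, expNorm (gaussDiv (b τ)) ≠ ∞) (hsT : s ≤ T) :
    2 * Real.exp (-(Real.exp (expDivIntegral b s T) * Real.log (2 / (gaussMeasure n).real A))) ≤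
      (gaussMeasure n).real ((fun x => γ x T) '' A) := by
  set B := expDivIntegral b s T with hB
  set L := Real.log (2 / (gaussMeasure n).real A) with hL
  set G := ∫ τ, g τ with hG
  have hG0 : 0 ≤ G := integral_nonneg hb.nonneg
  have hcont : ContinuousOn (fun x => γ x T) A := by
    refine LipschitzOnWith.continuousOn
      (K := (Real.exp (∫ r in s..T, g r)).toNNReal) (LipschitzOnWith.of_dist_le_mul ?_)
    intro x hx y hy
    rw [dist_eq_norm, dist_eq_norm, Real.coe_toNNReal _ (Real.exp_pos _).le, mul_comm]
    exact (hγ x hx).norm_sub_le (hγ y hy) (fun τ hτ => (hγR x hx τ hτ).trans (by linarith))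
      (fun τ hτ => (hγR y hy τ hτ).trans (by linarith)) hb.integrable hb.nonneg hb.lip T
      ⟨hsT, le_rfl⟩
  have hcomp : IsCompact ((fun x => γ x T) '' A) := hA.image_of_continuousOn hcont
  -- The approximate image lies in the `δ`-thickening of the true image. With `δ` fixed, `η → 0`
  -- removes the accumulated error; then `δ → 0`, by continuity from above on a closed set.
  have hδ : ∀ δ > 0, 2 * Real.exp (-(Real.exp B * L)) ≤
      (gaussMeasure n).real (Metric.cthickening δ ((fun x => γ x T) '' A)) := by
    intro δ hδ
    have hη : ∀ η > 0, 2 * Real.exp (-(Real.exp B * (L + 2 * η * G))) ≤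
        (gaussMeasure n).real (Metric.cthickening δ ((fun x => γ x T) '' A)) := by
      intro η hη
      obtain ⟨ε₀, hε₀, hdet⟩ := exists_exp_trace_sub_le_abs_det n hη
      have hlim : Tendsto (fun ε : ℝ => ε * G * Real.exp G) (𝓝[>] 0) (𝓝 (0 * G * Real.exp G)) :=
        (by fun_prop : Continuous fun ε : ℝ => ε * G * Real.exp G).continuousWithinAt
      rw [zero_mul, zero_mul] at hlim
      obtain ⟨ε, hεG, hε0, hε⟩ := ((hlim.eventually (gt_mem_nhds (lt_min one_pos hδ))).and
        (eventually_mem_nhdsWithin.and (mem_nhdsWithin_of_mem_nhds (gt_mem_nhds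
          (lt_min (lt_min hε₀ one_pos) (mul_pos two_pos hη)))))).exists
      have hε' : ε < min (min ε₀ 1) (2 * η) := hε
      rw [lt_min_iff, lt_min_iff] at hε'
      rw [lt_min_iff] at hεG
      obtain ⟨Y, hY⟩ := hb.exists_isEulerApprox hA hA0 hγ hγR hβ hη
        (fun M hM => hdet M (hM.trans hε'.1.1.le)) hε0 hε'.1.2 hε'.2.le hεG.1 hsT
      have hGT : ∫ τ in Ioc s T, g τ ≤ G :=
        setIntegral_le_integral hb.integrable (Eventually.of_forall hb.nonneg)
      have hGT0 : 0 ≤ ∫ τ in Ioc s T, g τ := integral_nonneg hb.nonneg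
      have hsub : Y '' A ⊆ Metric.cthickening δ ((fun x => γ x T) '' A) := by
        rintro _ ⟨x, hx, rfl⟩
        refine Metric.mem_cthickening_of_dist_le _ (γ x T) _ _ ⟨x, hx, rfl⟩ ?_
        rw [dist_eq_norm]
        have hε0' : 0 ≤ ε := le_of_lt hε0
        refine (hY.error x hx).trans (le_trans ?_ hεG.2.le)
        gcongr
      have h1 : Real.log (2 / (gaussMeasure n).real (Y '' A)) ≤
          Real.exp B * (L + 2 * η * G) := hY.log_measure.trans (by gcongr)
      have h2 := hY.measure_pos
      refine le_trans ?_ (measureReal_mono hsub)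
      rw [Real.log_le_iff_le_exp (by positivity), div_le_iff₀ h2] at h1
      rw [Real.exp_neg, ← div_eq_mul_inv, div_le_iff₀ (Real.exp_pos _)]
      linarith
    have hlim : Tendsto (fun η : ℝ => 2 * Real.exp (-(Real.exp B * (L + 2 * η * G)))) (𝓝[>] 0)
        (𝓝 (2 * Real.exp (-(Real.exp B * (L + 2 * 0 * G))))) :=
      (by fun_prop : Continuous fun η : ℝ =>
        2 * Real.exp (-(Real.exp B * (L + 2 * η * G)))).continuousWithinAt
    rw [mul_zero, zero_mul, add_zero] at hlim
    exact le_of_tendsto hlim (eventually_mem_nhdsWithin.mono fun η h => hη η h)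
  have hlim := tendsto_measure_cthickening_of_isClosed (μ := gaussMeasure n)
    ⟨1, one_pos, measure_ne_top _ _⟩ hcomp.isClosed
  have hlim' : Tendsto (fun δ => (gaussMeasure n).real
      (Metric.cthickening δ ((fun x => γ x T) '' A))) (𝓝[>] 0)
      (𝓝 ((gaussMeasure n).real ((fun x => γ x T) '' A))) :=
    ((ENNReal.tendsto_toReal (measure_ne_top _ _)).comp hlim).mono_left nhdsWithin_le_nhds
  exact ge_of_tendsto hlim' (eventually_mem_nhdsWithin.mono fun δ h => hδ δ h)

end IsLipschitzOnBall

/-! ### The transported measure is dominated by a power of the Gaussian measure. -/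

theorem IsOsgoodField.exists_isLipschitzOnBall {n : ℕ} {b : ℝ → Euc n → Euc n} {a : ℝ → ℝ}
    (hb : IsOsgoodField b a) (hd : ∀ t, Differentiable ℝ (b t)) {R : ℝ} (hR : 0 ≤ R) :
    ∃ g, IsLipschitzOnBall b R g := by
  obtain ⟨l, hl, hl0, hlip⟩ := hb.locallyLipschitz R
  have hlp := one_le_logPlus R
  have hm0 : ∀ t, 0 ≤ a t * (1 + R * logPlus R) := fun t =>
    mul_nonneg (hb.growth_nonneg t) (by positivity)
  refine ⟨fun t => l t + a t * (1 + R * logPlus R), hb.measurable, hd,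
    hl.add (hb.integrable_growth.mul_const _), fun t => add_nonneg (hl0 t) (hm0 t),
    fun t x y hx hy => (hlip t x y hx hy).trans ?_, fun t x hx => ?_⟩
  · exact mul_le_mul_of_nonneg_right (by linarith [hm0 t]) (norm_nonneg _)
  · exact (hb.norm_le_of_norm_le t hx).trans (by linarith [hl0 t])

/-- The flow of a field with divergence in `Exp_μ(L)` transports the Gaussian measure to a measure
dominated by a power of it. -/
theorem IsOsgoodField.measure_preimage_le {n : ℕ} {b : ℝ → Euc n → Euc n} {a : ℝ → ℝ}
    (hb : IsOsgoodField b a) (hd : ∀ t, Differentiable ℝ (b t)) {X : Euc n → ℝ → Euc n} {s t : ℝ}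
    (hst : s ≤ t) (hX : ∀ x, IsTrajectory b t s x (X x)) (hXm : Measurable fun x => X x t)
    (hβ : ∫⁻ τ in Ioc s t, expNorm (gaussDiv (b τ)) ≠ ∞) {D : Set (Euc n)}
    (hD : MeasurableSet D) :
    (gaussMeasure n).real ((fun x => X x t) ⁻¹' D) ≤
      2 * ((gaussMeasure n).real D / 2) ^ Real.exp (-expDivIntegral b s t) := by
  set B := expDivIntegral b s t with hB
  set w := (gaussMeasure n).real D with hw
  by_contra! hlt
  have h0 : 0 ≤ 2 * (w / 2) ^ Real.exp (-B) := by positivity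
  have hlt' : ENNReal.ofReal (2 * (w / 2) ^ Real.exp (-B)) <
      gaussMeasure n ((fun x => X x t) ⁻¹' D) := by
    rwa [ENNReal.ofReal_lt_iff_lt_toReal h0 (measure_ne_top _ _)]
  -- Inner regularity supplies a compact set of starting points, so that one ball contains all
  -- trajectories; the radius `R + 1` below leaves the margin needed by Euler's method.
  obtain ⟨A, hAD, hA, hAlt⟩ := (hXm hD).exists_lt_isCompact hlt'
  rw [ENNReal.ofReal_lt_iff_lt_toReal h0 (measure_ne_top _ _)] at hAlt
  change _ < (gaussMeasure n).real A at hAlt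
  have hA0 : 0 < (gaussMeasure n).real A := h0.trans_lt hAlt
  obtain ⟨ρ, hρ⟩ := hA.exists_bound_of_continuousOn (f := id) continuousOn_id
  set R := osgoodBound (max ρ 0) (∫ r, a r) with hR
  have hR0 : 0 ≤ R := (Real.exp_pos _).le
  obtain ⟨g, hg⟩ := hb.exists_isLipschitzOnBall hd (R := R + 1) (by linarith)
  have hmain := hg.two_mul_exp_le_measure_image hA hA0 (fun x _ => hX x)
    (fun x hx τ hτ => by
      rw [add_sub_cancel_right]
      refine ((hX x).norm_le_osgoodBound hb.integrable_growth hb.growth_nonneg hb.growth τ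
        hτ).trans (osgoodBound_mono (norm_nonneg x) ((hρ x hx).trans (le_max_left _ _)) le_rfl))
    hβ hst
  have himg : (gaussMeasure n).real ((fun x => X x t) '' A) ≤ w :=
    measureReal_mono (image_subset_iff.2 hAD)
  have h1 := hmain.trans himg
  have hw0 : 0 < w := lt_of_lt_of_le (by positivity) h1
  -- The image of `A` lies in `D`. Taking logarithms and multiplying by `exp (-B)` inverts the lower
  -- bound into an upper bound for `μ(A)`, against the choice of `A`.
  have h2 : -(Real.exp B * Real.log (2 / (gaussMeasure n).real A)) ≤ Real.log (w / 2) := by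
    rw [Real.le_log_iff_exp_le (by positivity)]
    linarith
  have h3 : Real.log ((gaussMeasure n).real A / 2) ≤ Real.log (w / 2) * Real.exp (-B) := by
    have h4 := mul_le_mul_of_nonneg_right h2 (Real.exp_pos (-B)).le
    have h5 : Real.exp B * Real.exp (-B) = 1 := by rw [← Real.exp_add]; simp
    rw [show (gaussMeasure n).real A / 2 = (2 / (gaussMeasure n).real A)⁻¹ by rw [inv_div],
      Real.log_inv]
    calc _ = -(Real.exp B * Real.log (2 / (gaussMeasure n).real A)) * Real.exp (-B) := by
          rw [neg_mul, mul_right_comm, h5, one_mul]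
      _ ≤ _ := h4
  rw [Real.log_le_iff_le_exp (by positivity), ← Real.rpow_def_of_pos (by positivity)] at h3
  linarith

/-! ### From power domination to `Lᵖ` bounds for the density. -/

/-- The bound for `∫ K ^ p` when `K` is the density of a measure dominated by the power `θ` of the
reference measure. -/
noncomputable def densityBound (p θ : ℝ) : ℝ := 1 + 2 * p * (1 - θ) / (1 - p * (1 - θ))

/-- For the superlevel set `D`, Chebyshev gives `t μ(D) ≤ ν(D) ≤ 2 (μ(D) / 2) ^ θ`, to be solved for
`μ(D)`. At `θ = 1` the exponent degenerates, but `t > 1` then forces `μ(D) = 0`; the disjunction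
records this. -/
theorem measureReal_lt_rnDeriv_le {α : Type*} [MeasurableSpace α] {μ ν : Measure α}
    [IsProbabilityMeasure μ] [IsFiniteMeasure ν] {θ : ℝ}
    (h : ∀ D, MeasurableSet D → ν.real D ≤ 2 * (μ.real D / 2) ^ θ) {t : ℝ} (ht : 1 < t) :
    μ.real {x | t < (ν.rnDeriv μ x).toReal} = 0 ∨
      θ ≠ 1 ∧ (θ < 1 → μ.real {x | t < (ν.rnDeriv μ x).toReal} ≤ 2 * t ^ (-(1 / (1 - θ)))) := by
  set D := {x | t < (ν.rnDeriv μ x).toReal} with hDdef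
  have hD : MeasurableSet D :=
    measurableSet_lt measurable_const (Measure.measurable_rnDeriv ν μ).ennreal_toReal
  set w := μ.real D with hw
  rcases (measureReal_nonneg : 0 ≤ μ.real D).eq_or_lt with h0 | hpos
  · exact Or.inl h0.symm
  right
  have ht0 : 0 < t := by linarith
  have h1 : t * w ≤ ν.real D := by
    have h2 : ENNReal.ofReal t * μ D ≤ ν D := by
      calc ENNReal.ofReal t * μ D = ∫⁻ _ in D, ENNReal.ofReal t ∂μ := (setLIntegral_const _ _).symm
        _ ≤ ∫⁻ x in D, ν.rnDeriv μ x ∂μ := by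
          refine setLIntegral_mono' hD fun x hx => ?_
          exact (ENNReal.ofReal_le_ofReal (le_of_lt hx)).trans ENNReal.ofReal_toReal_le
        _ ≤ ν D := Measure.setLIntegral_rnDeriv_le D
    have h3 := ENNReal.toReal_mono (measure_ne_top ν D) h2
    rwa [ENNReal.toReal_mul, ENNReal.toReal_ofReal ht0.le] at h3
  have h4 := h1.trans (h D hD)
  have hu : 0 < w / 2 := by positivity
  have h5 : (w / 2) ^ (1 - θ) ≤ t⁻¹ := by
    rw [Real.rpow_sub hu, Real.rpow_one, div_le_iff₀ (Real.rpow_pos_of_pos hu θ),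
      inv_mul_eq_div, le_div_iff₀ ht0]
    linarith
  refine ⟨?_, fun hθ => ?_⟩
  · rintro rfl
    rw [sub_self, Real.rpow_zero] at h5
    exact absurd h5 (not_le.2 (inv_lt_one_of_one_lt₀ ht))
  · have hq : 0 < 1 - θ := by linarith
    have h6 := Real.rpow_le_rpow (by positivity) h5 (by positivity : 0 ≤ 1 / (1 - θ))
    rw [← Real.rpow_mul hu.le, mul_one_div_cancel hq.ne', Real.rpow_one, Real.inv_rpow ht0.le,
      ← Real.rpow_neg ht0.le] at h6
    linarith

theorem lintegral_Ioc_zero_one_rpow {p : ℝ} (hp : 0 < p) :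
    ∫⁻ t in Ioc (0 : ℝ) 1, ENNReal.ofReal (t ^ (p - 1)) = ENNReal.ofReal (1 / p) := by
  have hi : IntervalIntegrable (fun t : ℝ => t ^ (p - 1)) volume 0 1 :=
    intervalIntegral.intervalIntegrable_rpow' (by linarith)
  rw [← ofReal_integral_eq_lintegral_ofReal hi.1, ← intervalIntegral.integral_of_le zero_le_one,
    integral_rpow (Or.inl (by linarith))]
  · simp [hp.ne']
  · rw [EventuallyLE, ae_restrict_iff' measurableSet_Ioc]
    exact Eventually.of_forall fun t ht => Real.rpow_nonneg ht.1.le _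

theorem lintegral_Ioi_one_rpow {r : ℝ} (hr : r < -1) :
    ∫⁻ t in Ioi (1 : ℝ), ENNReal.ofReal (t ^ r) = ENNReal.ofReal (1 / (-r - 1)) := by
  rw [← ofReal_integral_eq_lintegral_ofReal (integrableOn_Ioi_rpow_of_lt hr one_pos),
    integral_Ioi_rpow_of_lt hr one_pos]
  · rw [Real.one_rpow, neg_div, ← div_neg]
    congr 2
    ring
  · rw [EventuallyLE, ae_restrict_iff' measurableSet_Ioi]
    exact Eventually.of_forall fun t ht => Real.rpow_nonneg (zero_le_one.trans (le_of_lt ht)) _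

/-- Layer cake: levels below `1` contribute at most `1` because `μ` is a probability. Above `1` the
integrand decays like `t ^ (p - 1 - 1 / (1 - θ))`, integrable exactly when `p (1 - θ) < 1`. -/
theorem lintegral_rnDeriv_rpow_le {α : Type*} [MeasurableSpace α] {μ ν : Measure α}
    [IsProbabilityMeasure μ] [IsFiniteMeasure ν] {θ p : ℝ} (hθ : θ ≤ 1)
    (h : ∀ D, MeasurableSet D → ν.real D ≤ 2 * (μ.real D / 2) ^ θ) (hp : 1 ≤ p)
    (hpθ : p * (1 - θ) < 1) :
    ∫⁻ x, ν.rnDeriv μ x ^ p ∂μ ≤ ENNReal.ofReal (densityBound p θ) := by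
  have hp0 : 0 < p := by linarith
  set f : α → ℝ := fun x => (ν.rnDeriv μ x).toReal with hf
  have hfm : Measurable f := (Measure.measurable_rnDeriv ν μ).ennreal_toReal
  have e1 : ∫⁻ x, ν.rnDeriv μ x ^ p ∂μ = ∫⁻ x, ENNReal.ofReal (f x ^ p) ∂μ := by
    refine lintegral_congr_ae ?_
    filter_upwards [Measure.rnDeriv_lt_top ν μ] with x hx
    rw [← ENNReal.ofReal_rpow_of_nonneg ENNReal.toReal_nonneg hp0.le,
      ENNReal.ofReal_toReal hx.ne]
  rw [e1, lintegral_rpow_eq_lintegral_meas_lt_mul μ (Eventually.of_forall fun x =>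
    ENNReal.toReal_nonneg) hfm.aemeasurable hp0, ← Ioc_union_Ioi_eq_Ioi zero_le_one,
    lintegral_union measurableSet_Ioi (Set.disjoint_left.2 fun x hx hx' =>
      absurd hx.2 (not_le.2 hx'))]
  have h1 : ∫⁻ t in Ioc (0 : ℝ) 1, μ {x | t < f x} * ENNReal.ofReal (t ^ (p - 1)) ≤
      ENNReal.ofReal (1 / p) := by
    rw [← lintegral_Ioc_zero_one_rpow hp0]
    exact lintegral_mono fun t => mul_le_of_le_one_left' prob_le_one
  have h2 : ∫⁻ t in Ioi (1 : ℝ), μ {x | t < f x} * ENNReal.ofReal (t ^ (p - 1)) ≤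
      ENNReal.ofReal (2 * (1 - θ) / (1 - p * (1 - θ))) := by
    rcases hθ.eq_or_lt with rfl | hθ1
    · rw [sub_self, mul_zero, zero_div, ENNReal.ofReal_zero, nonpos_iff_eq_zero]
      refine (setLIntegral_congr_fun measurableSet_Ioi fun t ht => ?_).trans lintegral_zero
      rcases measureReal_lt_rnDeriv_le h ht with h3 | h3
      · rw [measureReal_eq_zero_iff] at h3
        rw [h3, zero_mul]
      · exact absurd rfl h3.1
    · have hq : 0 < 1 - θ := by linarith
      have hpq : p < 1 / (1 - θ) := by rwa [lt_div_iff₀ hq]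
      have hr : p - 1 - 1 / (1 - θ) < -1 := by linarith
      calc ∫⁻ t in Ioi (1 : ℝ), μ {x | t < f x} * ENNReal.ofReal (t ^ (p - 1))
          ≤ ∫⁻ t in Ioi (1 : ℝ), ENNReal.ofReal 2 *
              ENNReal.ofReal (t ^ (p - 1 - 1 / (1 - θ))) := by
            refine setLIntegral_mono' measurableSet_Ioi fun t ht => ?_
            have ht0 : 0 < t := one_pos.trans ht
            have h3 : μ.real {x | t < f x} ≤ 2 * t ^ (-(1 / (1 - θ))) := by
              rcases measureReal_lt_rnDeriv_le h ht with h3 | h3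
              · exact h3.le.trans (by positivity)
              · exact h3.2 hθ1
            rw [← ofReal_measureReal (measure_ne_top μ _),
              ← ENNReal.ofReal_mul measureReal_nonneg, ← ENNReal.ofReal_mul zero_le_two]
            refine ENNReal.ofReal_le_ofReal ?_
            calc _ ≤ 2 * t ^ (-(1 / (1 - θ))) * t ^ (p - 1) := by gcongr
              _ = _ := by rw [mul_assoc, ← Real.rpow_add ht0]; congr 2; ring
        _ = ENNReal.ofReal (2 * (1 - θ) / (1 - p * (1 - θ))) := by
            rw [lintegral_const_mul' _ _ ENNReal.ofReal_ne_top, lintegral_Ioi_one_rpow hr,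
              ← ENNReal.ofReal_mul zero_le_two]
            congr 1
            have h4 : 1 - p * (1 - θ) ≠ 0 := by linarith
            have h5 : -(p - 1 - 1 / (1 - θ)) - 1 = (1 - p * (1 - θ)) / (1 - θ) := by
              field_simp
              ring
            rw [h5]
            field_simp
  calc _ ≤ ENNReal.ofReal p * (ENNReal.ofReal (1 / p) +
        ENNReal.ofReal (2 * (1 - θ) / (1 - p * (1 - θ)))) := by gcongr
    _ = ENNReal.ofReal (densityBound p θ) := by
        have h3 : 0 ≤ 2 * (1 - θ) / (1 - p * (1 - θ)) :=
          div_nonneg (by linarith) (by linarith)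
        rw [← ENNReal.ofReal_add (by positivity) h3, ← ENNReal.ofReal_mul hp0.le]
        congr 1
        unfold densityBound
        field_simp

/-! ### Exceptional times and the main theorem. -/

/-- A continuous function is bounded everywhere by its essential supremum. -/
theorem Continuous.enorm_le_eLpNorm_top {α E : Type*} [TopologicalSpace α] [MeasurableSpace α]
    [NormedAddCommGroup E] {μ : Measure α} [μ.IsOpenPosMeasure] {f : α → E} (hf : Continuous f)
    (x : α) : ‖f x‖ₑ ≤ eLpNorm f ∞ μ := by
  rw [eLpNorm_exponent_top]
  have h : Dense {y | ‖f y‖ₑ ≤ eLpNormEssSup f μ} :=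
    Measure.dense_of_ae (ae_le_eLpNormEssSup (f := f) (μ := μ))
  have hc : IsClosed {y | ‖f y‖ₑ ≤ eLpNormEssSup f μ} := isClosed_le hf.enorm continuous_const
  have := h.closure_eq
  rw [hc.closure_eq] at this
  exact eq_univ_iff_forall.1 this x

theorem IsTrajectory.congr_field {n : ℕ} {b b' : ℝ → Euc n → Euc n} {T s : ℝ} {x : Euc n}
    {γ : ℝ → Euc n} (h : IsTrajectory b T s x γ) (hsT : s ≤ T)
    (hbb : ∀ᵐ r ∂(volume.restrict (Ioc s T)), b r = b' r) : IsTrajectory b' T s x γ where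
  integrable := h.integrable.congr_ae (by
    rw [uIoc_of_le hsT]
    filter_upwards [hbb] with r hr using by rw [hr])
  eq_integral t ht := by
    rw [h.eq_integral t ht, intervalIntegral.integral_of_le ht.1,
      intervalIntegral.integral_of_le ht.1]
    congr 1
    refine integral_congr_ae ?_
    filter_upwards [ae_restrict_of_ae_restrict_of_subset (Ioc_subset_Ioc_right ht.2) hbb]
      with r hr using by rw [hr]

/-- A field with integrable growth and derivative bounds agrees, for almost every time, with a field
that satisfies the estimates at all times. -/
theorem exists_isOsgoodField {n : ℕ} {T : ℝ} {b : ℝ → Euc n → Euc n}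
    (hb : Measurable (Function.uncurry b)) (hC : ∀ t ∈ Icc 0 T, ContDiff ℝ 2 (b t))
    (hl : ∀ R : ℝ, ∃ l : ℝ → ℝ, IntegrableOn l (Ioc 0 T) ∧
      ∀ᵐ t ∂(volume.restrict (Ioc 0 T)), ∀ x : Euc n, ‖x‖ ≤ R → ‖fderiv ℝ (b t) x‖ ≤ l t)
    (hg : ∫⁻ t in Ioc 0 T,
      eLpNorm (fun x : Euc n => ‖b t x‖ / (1 + ‖x‖ * logPlus ‖x‖)) ∞ volume < ∞) :
    ∃ (b' : ℝ → Euc n → Euc n) (a : ℝ → ℝ), IsOsgoodField b' a ∧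
      (∀ t, Differentiable ℝ (b' t)) ∧ ∀ᵐ t ∂(volume.restrict (Ioc 0 T)), b t = b' t := by
  classical
  have hden : ∀ x : Euc n, 0 < 1 + ‖x‖ * logPlus ‖x‖ := fun x => by
    have := one_le_logPlus ‖x‖
    positivity
  set q : ℕ → Euc n := TopologicalSpace.denseSeq (Euc n) with hq
  set F : ℝ → Euc n → ℝ := fun t x => ‖b t x‖ / (1 + ‖x‖ * logPlus ‖x‖) with hF
  have hFc : ∀ t ∈ Icc 0 T, Continuous (F t) := fun t ht =>
    (hC t ht).continuous.norm.div
      (continuous_const.add (continuous_norm.mul (continuous_logPlus.comp continuous_norm)))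
      fun x => (hden x).ne'
  -- A countable supremum is measurable in time, and continuity in space makes it a bound at every
  -- point.
  set A : ℝ → ℝ≥0∞ := fun t => ⨆ k, ‖F t (q k)‖ₑ with hA
  have hAm : Measurable A := by
    refine Measurable.iSup fun k => Measurable.enorm ?_
    exact ((hb.comp (measurable_id.prodMk measurable_const)).norm).div_const _
  have hAint : ∫⁻ t in Ioc 0 T, A t < ∞ := by
    refine lt_of_le_of_lt (setLIntegral_mono' measurableSet_Ioc fun t ht => ?_) hg
    exact iSup_le fun k => (hFc t (Ioc_subset_Icc_self ht)).enorm_le_eLpNorm_top _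
  set S : Set ℝ := {t | t ∈ Ioc 0 T ∧ A t < ∞} with hS
  have hSm : MeasurableSet S := measurableSet_Ioc.inter (measurableSet_lt hAm measurable_const)
  have hSae : ∀ᵐ t ∂(volume.restrict (Ioc 0 T)), t ∈ S := by
    filter_upwards [ae_lt_top hAm hAint.ne, ae_restrict_mem measurableSet_Ioc] with t h1 h2
    exact ⟨h2, h1⟩
  have hSI : ∀ t ∈ S, t ∈ Icc 0 T := fun t ht => Ioc_subset_Icc_self ht.1
  set b' : ℝ → Euc n → Euc n := fun t x => if t ∈ S then b t x else 0 with hb'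
  have hb'S : ∀ t ∈ S, b' t = b t := fun t ht => by funext x; simp [hb', ht]
  have hb'0 : ∀ t ∉ S, b' t = 0 := fun t ht => by funext x; simp [hb', ht]
  refine ⟨b', S.indicator fun t => (A t).toReal, ⟨?_, ?_, ?_, ?_, fun R => ?_⟩, fun t => ?_, ?_⟩
  · exact Measurable.ite (measurable_fst hSm) hb measurable_const
  · rw [integrable_indicator_iff hSm]
    refine integrable_toReal_of_lintegral_ne_top hAm.aemeasurable ?_
    exact ((lintegral_mono_set fun t ht => ht.1).trans_lt hAint).ne
  · exact fun t => indicator_nonneg (fun t _ => ENNReal.toReal_nonneg) t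
  · intro t x
    by_cases ht : t ∈ S
    · rw [hb'S t ht, indicator_of_mem ht, ← div_le_iff₀ (hden x)]
      have hcl : IsClosed {y | F t y ≤ (A t).toReal} :=
        isClosed_le (hFc t (hSI t ht)) continuous_const
      have hsub : range q ⊆ {y | F t y ≤ (A t).toReal} := by
        rintro _ ⟨k, rfl⟩
        have h1 : ‖F t (q k)‖ₑ ≤ A t := le_iSup (fun k => ‖F t (q k)‖ₑ) k
        have h2 := ENNReal.toReal_mono ht.2.ne h1
        rw [toReal_enorm] at h2
        exact (le_abs_self _).trans h2
      exact closure_minimal hsub hcl (TopologicalSpace.denseRange_denseSeq (Euc n) x)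
    · rw [hb'0 t ht, indicator_of_notMem ht]
      simp
  · obtain ⟨l, hli, hlb⟩ := hl R
    -- `l` is a bound only for almost every time. At exceptional times in `S` compactness of the
    -- ball gives some constant; since these times are null, `c` inherits integrability from `|l|`.
    have hex : ∀ t, ∃ c : ℝ, 0 ≤ c ∧ (t ∉ S → c = 0) ∧
        (t ∈ S → ∀ x : Euc n, ‖x‖ ≤ R → ‖fderiv ℝ (b t) x‖ ≤ c) ∧
        (t ∈ S → (∀ x : Euc n, ‖x‖ ≤ R → ‖fderiv ℝ (b t) x‖ ≤ l t) → c = |l t|) := by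
      intro t
      by_cases ht : t ∈ S
      · by_cases hgood : ∀ x : Euc n, ‖x‖ ≤ R → ‖fderiv ℝ (b t) x‖ ≤ l t
        · exact ⟨|l t|, abs_nonneg _, fun h => absurd ht h,
            fun _ x hx => (hgood x hx).trans (le_abs_self _), fun _ _ => rfl⟩
        · obtain ⟨c, hc⟩ := (isCompact_closedBall (0 : Euc n) R).exists_bound_of_continuousOn
            ((hC t (hSI t ht)).continuous_fderiv two_ne_zero).continuousOn
          exact ⟨max c 0, le_max_right _ _, fun h => absurd ht h, fun _ x hx =>
            (hc x (mem_closedBall_zero_iff.2 hx)).trans (le_max_left _ _),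
            fun _ h => absurd h hgood⟩
      · exact ⟨0, le_rfl, fun _ => rfl, fun h => absurd h ht, fun h => absurd h ht⟩
    choose c hc0 hcS hcb hcl using hex
    refine ⟨c, ?_, hc0, fun t x y hx hy => ?_⟩
    · have h1 : Integrable ((Ioc 0 T).indicator fun t => |l t|) :=
        (integrable_indicator_iff measurableSet_Ioc).2 hli.abs
      refine h1.congr ?_
      rw [ae_restrict_iff' measurableSet_Ioc] at hlb hSae
      filter_upwards [hlb, hSae] with t h2 h3
      by_cases ht : t ∈ Ioc 0 T
      · rw [indicator_of_mem ht, hcl t (h3 ht) (h2 ht)]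
      · rw [indicator_of_notMem ht, hcS t fun h => ht h.1]
    · by_cases ht : t ∈ S
      · rw [hb'S t ht]
        exact (convex_closedBall (0 : Euc n) R).norm_image_sub_le_of_norm_fderiv_le
          (fun z _ => (hC t (hSI t ht)).differentiable two_ne_zero z)
          (fun z hz => hcb t ht z (mem_closedBall_zero_iff.1 hz))
          (mem_closedBall_zero_iff.2 hy) (mem_closedBall_zero_iff.2 hx)
      · rw [hb'0 t ht]
        simpa using mul_nonneg (hc0 t) (norm_nonneg (x - y))
  · by_cases ht : t ∈ S
    · rw [hb'S t ht]
      exact (hC t (hSI t ht)).differentiable two_ne_zero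
    · rw [hb'0 t ht]
      exact differentiable_const 0
  · filter_upwards [hSae] with t ht using (hb'S t ht).symm

theorem theorem3p1 :
    -- the constant in the bound depends on `p` and on `∫ₛᵗ ‖div_μ b(r,·)‖ dr` only
    ∃ C : ℝ → ℝ → ℝ,
      ∀ (n : ℕ) (T : ℝ) (_ : 0 < T) (b : ℝ → Euc n → Euc n)
        (_ : Measurable (Function.uncurry b))
        (_ : ∀ t ∈ Icc 0 T, ContDiff ℝ 2 (b t))
        -- the spatial derivative is bounded on balls, integrably in time
        (_ : ∀ R : ℝ, ∃ l : ℝ → ℝ, IntegrableOn l (Ioc 0 T) ∧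
          ∀ᵐ t ∂(volume.restrict (Ioc 0 T)), ∀ x : Euc n, ‖x‖ ≤ R → ‖fderiv ℝ (b t) x‖ ≤ l t)
        (_ : ∫⁻ t in Ioc 0 T,
          eLpNorm (fun x : Euc n => ‖b t x‖ / (1 + ‖x‖ * logPlus ‖x‖)) ∞ volume < ∞)
        (_ : ∫⁻ t in Ioc 0 T, expNorm (gaussDiv (b t)) < ∞),
        ∃ X : ℝ → ℝ → Euc n → Euc n,
          IsFlow b T X ∧
          -- uniqueness, trajectory by trajectory
          (∀ s ∈ Icc 0 T, ∀ (x : Euc n) (γ : ℝ → Euc n), IsTrajectory b T s x γ →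
            ∀ t ∈ Icc s T, γ t = X s t x) ∧
          ∀ s t : ℝ, 0 ≤ s → s ≤ t → t ≤ T →
            (gaussMeasure n).map (X s t) ≪ gaussMeasure n ∧
            -- `p < 1 / (1 - exp (-4 ∫ₛᵗ β))`, where the right side is `∞` if `∫ₛᵗ β = 0`
            ∀ p : ℝ, 1 ≤ p → p * (1 - Real.exp (-4 * expDivIntegral b s t)) < 1 →
              MemLp (fun x => (gaussDensity (X s t) x).toReal) (ENNReal.ofReal p)
                (gaussMeasure n) ∧
              ∫⁻ x, gaussDensity (X s t) x ^ p ∂(gaussMeasure n) ≤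
                ENNReal.ofReal (C p (expDivIntegral b s t)) := by
  refine ⟨fun p B => densityBound p (Real.exp (-B)), ?_⟩
  intro n T _ b hb hC hl hg hβ
  obtain ⟨b', a, hb', hd, hae⟩ := exists_isOsgoodField hb hC hl hg
  obtain ⟨X, hXm, hX⟩ := hb'.exists_flow
  have hae' : ∀ {s t : ℝ}, 0 ≤ s → t ≤ T → ∀ᵐ r ∂(volume.restrict (Ioc s t)), b r = b' r :=
    fun hs ht => ae_restrict_of_ae_restrict_of_subset (Ioc_subset_Ioc hs ht) hae
  refine ⟨X, ⟨hXm, fun s hs x => ?_⟩, fun s hs x γ hγ => ?_, fun s t hs hst htT => ?_⟩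
  · exact (hX s T x hs.2).congr_field hs.2 ((hae' hs.1 le_rfl).mono fun r hr => hr.symm)
  · exact hb'.trajectory_unique (hγ.congr_field hs.2 (hae' hs.1 le_rfl)) (hX s T x hs.2)
  have hXst : Measurable (X s t) :=
    hXm.comp (measurable_const.prodMk (measurable_const.prodMk measurable_id))
  have hint : ∫⁻ r in Ioc s t, expNorm (gaussDiv (b r)) =
      ∫⁻ r in Ioc s t, expNorm (gaussDiv (b' r)) := by
    refine lintegral_congr_ae ?_
    filter_upwards [hae' hs htT] with r hr using by rw [hr]
  have hB : expDivIntegral b s t = expDivIntegral b' s t := congrArg ENNReal.toReal hint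
  have hfin : ∫⁻ r in Ioc s t, expNorm (gaussDiv (b' r)) ≠ ∞ := by
    rw [← hint]
    exact ((lintegral_mono_set (Ioc_subset_Ioc hs htT)).trans_lt hβ).ne
  have hpush : ∀ D, MeasurableSet D → ((gaussMeasure n).map (X s t)).real D ≤
      2 * ((gaussMeasure n).real D / 2) ^ Real.exp (-expDivIntegral b s t) := fun D hD => by
    rw [map_measureReal_apply hXst hD, hB]
    exact hb'.measure_preimage_le hd (X := fun x τ => X s τ x) hst (fun x => hX s t x hst) hXst
      hfin hD
  have hB0 : 0 ≤ expDivIntegral b s t := ENNReal.toReal_nonneg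
  have : IsProbabilityMeasure ((gaussMeasure n).map (X s t)) :=
    Measure.isProbabilityMeasure_map hXst.aemeasurable
  refine ⟨Measure.AbsolutelyContinuous.mk fun D hD h0 => ?_, fun p hp hpB => ?_⟩
  · have h1 := hpush D hD
    rw [measureReal_def (gaussMeasure n), h0, ENNReal.toReal_zero, zero_div,
      Real.zero_rpow (Real.exp_pos _).ne', mul_zero] at h1
    exact (measureReal_eq_zero_iff).1 (le_antisymm h1 measureReal_nonneg)
  have hp0 : 0 < p := by linarith
  have hbound : ∫⁻ x, gaussDensity (X s t) x ^ p ∂(gaussMeasure n) ≤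
      ENNReal.ofReal (densityBound p (Real.exp (-expDivIntegral b s t))) := by
    refine lintegral_rnDeriv_rpow_le (Real.exp_le_one_iff.2 (by linarith)) hpush hp
      (lt_of_le_of_lt ?_ hpB)
    -- The argument reaches all `p` with `p (1 - exp (-∫β)) < 1`; the constant `4` of the statement
    -- is only a weakening.
    have : Real.exp (-4 * expDivIntegral b s t) ≤ Real.exp (-expDivIntegral b s t) :=
      Real.exp_le_exp.2 (by linarith)
    gcongr
  refine ⟨⟨(Measure.measurable_rnDeriv _ _).ennreal_toReal.aestronglyMeasurable, ?_⟩, hbound⟩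
  rw [eLpNorm_lt_top_iff_lintegral_rpow_enorm_lt_top (by simpa using hp0) ENNReal.ofReal_ne_top,
    ENNReal.toReal_ofReal hp0.le]
  refine lt_of_le_of_lt (lintegral_mono fun x => ?_) (hbound.trans_lt ENNReal.ofReal_lt_top)
  refine ENNReal.rpow_le_rpow ?_ hp0.le
  rw [Real.enorm_of_nonneg ENNReal.toReal_nonneg]
  exact ENNReal.ofReal_toReal_le
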